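/- All map-germs are $C^\infty$. Let $f:(\mathbb R^2,0)\to(\mathbb R^3,0)$ be a cuspidal edge, i.e. $f=\Phi_t\circ f_0\circ\Phi_s^{-1}$ for diffeomorphism-germs $\Phi_s,\Phi_t$ of $(\mathbb R^2,0),(\mathbb R^3,0)$ and $f_0(u,v)=(u,v^2,v^3)$. Let $\nu$ be a smooth unit normal vector field of $f$ and $S(f)$ the singular set of $f$, parametrized by a regular curve $\mu$ with $\mu(0)=0$. *Invariants of $f$.* Let $(\xi,\eta)$ be a positively oriented pair of vector fields such that, along $S(f)$, $\xi$ is nonzero and tangent to $S(f)$ and $\eta$ generates $\ker df$. Write $\zeta^i f$ for the $i$-th iterated directional derivative of $f$ along a vector field $\zeta$. The $(2,3)$-cuspidal curvature (the cuspidal curvature $\kappa_c$) and the cuspidal torsion are $$\omega_{2,3}=\frac{|\xi f|^{3/2}\det(\xi f,\eta^2f,\eta^3f)}{|\xi f\times\eta^2f|^{5/2}}\circ\mu,\qquad \kappa_t=\left(\frac{\det(\xi f,\eta^2f,\xi\eta^2f)}{|\xi f\times\eta^2f|^2}-\frac{\det(\xi f,\eta^2f,\xi^2f)\,\langle\xi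 f,\eta^2f\rangle}{|\xi f|^2|\xi f\times\eta^2f|^2}\right)\circ\mu .$$ *The curve.* Let $(u,v)$ be a positively oriented coordinate system at $0$ and $A\in SO(3)$ such that $f$ has the normal form $$Af(u,v)=\Bigl(u,\ \tfrac{u^2a(u)}2+\tfrac{v^2}{2},\ \tfrac{u^2b_0(u)}2+\tfrac{v^2}{2}b(u,v)\Bigr),\qquad b(0,0)=0,$$ with smooth $a,b_0,b$. Let $\gamma:(\mathbb R,0)\to(\mathbb R^2,0)$ be a regular curve which, in the coordinates $(u,v)$ and reparametrized by $v$, is $\tilde\gamma(t)=(x(t),t)$, where $x$ has finite order $l\ge2$ at $0$ ($l$ is the order of contact of $\gamma$ with the normalized null direction of $f$ at $0$; $l\geq 2$ means that $\gamma'(0)$ is a null vector). Let $\tilde\kappa=\det(\tilde\gamma',\tilde\gamma'')/|\tilde\gamma'|^3$ be the curvature of $\tilde\gamma$ in the Euclidean $(u,v)$-plane. With $\hat\gamma=f\circ\gamma$, and with $\nu$ and $\nu'$ taken along $\gamma$, put, for $t\neq0$ near $0$, $$\kappa_g=\frac{\det(\hat\gamma',\hat\gamma'',\nu)}{|\hat\gamma'|^3},\quad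 \kappa_n=\frac{\langle\hat\gamma'',\nu\rangle}{|\hat\gamma'|^2},\quad \tau_g=\frac{\det(\hat\gamma',\nu,\nu')}{|\hat\gamma'|^2}.$$ *Orders.* The order of a smooth function-germ of one variable is the least $k$ such that its $k$-th derivative at $0$ is nonzero ($\infty$ if there is none). If $h=g_1/(|g_2|g_3)$ for $t\ne0$ near $0$, with smooth germs $g_i$ and $g_2,g_3$ of finite order, then $\operatorname{ord}h=\operatorname{ord}g_1-\operatorname{ord}g_2-\operatorname{ord}g_3$. Then $\kappa_g,\kappa_n,\tau_g$ have well-defined orders, and the following holds. 1. For $\kappa_g$: - if $l=2$, then $\operatorname{ord}\kappa_g\ge-1$, with equality if and only if $\tilde\kappa^{(l-1)}(0)\neq0$; - if $l=3$ or $l=4$, then $\operatorname{ord}\kappa_g=l-4$; - if $l\ge5$, then $\operatorname{ord}\kappa_g\ge1$; equality holds if and only if $(l-1)!\,\kappa_t(0)\,\omega_{2,3}(0)-12\,\tilde\kappa^{(l-2)}(0)\ne0$ when $l=5$, and if and only if $\kappa_t(0)\,\omega_{2,3}(0)\neq0$ when $l>5$. 2. $\operatorname{ord}\kappa_n=-1$.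 3. For $\tau_g$: - if $l=2$ or $l=3$, then $\operatorname{ord}\tau_g\ge l-3$; equality holds if and only if $\omega_{2,3}(0)\ne0$ when $l=2$, and if and only if $2(l-1)!\,\kappa_t(0)+\tilde\kappa^{(l-2)}(0)\,\omega_{2,3}(0)\neq0$ when $l=3$; - if $l\ge4$, then $\operatorname{ord}\tau_g\ge0$, with equality if and only if $\kappa_t(0)\ne0$. -/

import Mathlib

open Filter Topology
open scoped ContDiff Nat Matrix

noncomputable section

/-- Euclidean three-space. The source plane is `ℝ × ℝ`, with coordinates `(u, v)`. -/
abbrev E3 : Type := EuclideanSpace ℝ (Fin 3)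

/-- `g` represents a `C^∞` map-germ at `x`: it is smooth at all points of a neighbourhood of `x`. -/
def SmoothGerm {E F : Type*} [NormedAddCommGroup E] [NormedSpace ℝ E]
    [NormedAddCommGroup F] [NormedSpace ℝ F] (g : E → F) (x : E) : Prop :=
  ∀ᶠ y in 𝓝 x, ContDiffAt ℝ ∞ g y

/-- `Φ : (E, 0) → (F, 0)` is a diffeomorphism-germ with inverse germ `Ψ`. -/
structure IsDiffeoGerm {E F : Type*} [NormedAddCommGroup E] [NormedSpace ℝ E]
    [NormedAddCommGroup F] [NormedSpace ℝ F] (Φ : E → F) (Ψ : F → E) : Prop where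
  smooth : SmoothGerm Φ 0
  smooth_inv : SmoothGerm Ψ 0
  map_zero : Φ 0 = 0
  inv_zero : Ψ 0 = 0
  left_inv : ∀ᶠ x in 𝓝 0, Ψ (Φ x) = x
  right_inv : ∀ᶠ y in 𝓝 0, Φ (Ψ y) = y

/-- Two map-germs `h₁, h₂ : (ℝ², 0) → (ℝ³, 0)` are `𝒜`-equivalent:
`h₂ = Φt ∘ h₁ ∘ Φs⁻¹` as germs at `0`, with diffeomorphism-germs `Φs`, `Φt`. -/
def AEquivalent (h₁ h₂ : ℝ × ℝ → E3) : Prop :=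
  ∃ (Φs Ψs : ℝ × ℝ → ℝ × ℝ) (Φt Ψt : E3 → E3),
    IsDiffeoGerm Φs Ψs ∧ IsDiffeoGerm Φt Ψt ∧ ∀ᶠ p in 𝓝 0, h₂ p = Φt (h₁ (Ψs p))

/-- `f` is a cuspidal edge at the origin: `𝒜`-equivalent to `(u, v) ↦ (u, v², v³)`. -/
def IsCuspidalEdge (f : ℝ × ℝ → E3) : Prop :=
  AEquivalent (fun p => !₂[p.1, p.2 ^ 2, p.2 ^ 3]) f

/-- `ν` is a (smooth) unit normal vector field of `f` near the origin. -/
structure IsUnitNormal (f ν : ℝ × ℝ → E3) : Prop where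
  smooth : SmoothGerm ν 0
  norm_eq_one : ∀ᶠ p in 𝓝 0, ‖ν p‖ = 1
  orthogonal : ∀ᶠ p in 𝓝 0, ∀ X : ℝ × ℝ, inner ℝ (fderiv ℝ f p X) (ν p) = 0

/-- The determinant of three vectors of `ℝ³`. -/
def det3 (x y z : E3) : ℝ := Matrix.det !![x 0, y 0, z 0; x 1, y 1, z 1; x 2, y 2, z 2]

/-- The vector product of `ℝ³`. -/
def cross3 (x y : E3) : E3 := WithLp.toLp 2 (crossProduct x.ofLp y.ofLp)

/-- The singular set `S(f)`: the points where `df` does not have rank two. -/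
def singularSet (f : ℝ × ℝ → E3) : Set (ℝ × ℝ) :=
  {p | ¬ Function.Injective (fderiv ℝ f p)}

/-- `μ : (ℝ, 0) → (ℝ², 0)` is a regular parametrization of `S(f)` near the origin. -/
structure IsSingularParam (f : ℝ × ℝ → E3) (μ : ℝ → ℝ × ℝ) : Prop where
  smooth : SmoothGerm μ 0
  map_zero : μ 0 = 0
  regular : deriv μ 0 ≠ 0
  mem : ∀ᶠ t in 𝓝 0, μ t ∈ singularSet f
  cover : ∀ V ∈ 𝓝 (0 : ℝ), μ '' V ∈ 𝓝[singularSet f] 0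

/-- The derivative `ζ g` of a map `g` along a vector field `ζ` of the plane;
the iterated derivative `ζⁱ g` is `(dirD ζ)^[i] g`. -/
def dirD (ζ : ℝ × ℝ → ℝ × ℝ) (g : ℝ × ℝ → E3) : ℝ × ℝ → E3 :=
  fun p => fderiv ℝ g p (ζ p)

/-- `(ξ, η)` is a positively oriented adapted pair of vector fields for `f`, whose singular set is
parametrized by `μ`: on `S(f)`, `ξ` is a nonzero tangent vector of `S(f)`, `η` generates the
kernel of `df`, and `ηⁱ f = 0` for `2 ≤ i ≤ m - 1`. -/
structure IsAdaptedPair (m : ℕ) (f : ℝ × ℝ → E3) (μ : ℝ → ℝ × ℝ)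
    (ξ η : ℝ × ℝ → ℝ × ℝ) : Prop where
  param : IsSingularParam f μ
  smooth_tangent : SmoothGerm ξ 0
  smooth_null : SmoothGerm η 0
  tangent : ∀ᶠ t in 𝓝 0, ∃ c : ℝ, c ≠ 0 ∧ ξ (μ t) = c • deriv μ t
  null : ∀ᶠ t in 𝓝 0, ∀ X : ℝ × ℝ, fderiv ℝ f (μ t) X = 0 ↔ ∃ c : ℝ, X = c • η (μ t)
  null_iterate : ∀ i : ℕ, 2 ≤ i → i < m → ∀ᶠ t in 𝓝 0, (dirD η)^[i] f (μ t) = 0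
  positive : ∀ᶠ t in 𝓝 0,
    0 < (ξ (μ t)).1 * (η (μ t)).2 - (ξ (μ t)).2 * (η (μ t)).1

/-- The `(m, m+1)`-cuspidal curvature `ω_{m,m+1}` along `μ`. -/
def cuspidalCurvature (m : ℕ) (f : ℝ × ℝ → E3) (ξ η : ℝ × ℝ → ℝ × ℝ) (μ : ℝ → ℝ × ℝ)
    (t : ℝ) : ℝ :=
  ‖dirD ξ f (μ t)‖ ^ (((m : ℝ) + 1) / m)
      * det3 (dirD ξ f (μ t)) ((dirD η)^[m] f (μ t)) ((dirD η)^[m + 1] f (μ t))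
    / ‖cross3 (dirD ξ f (μ t)) ((dirD η)^[m] f (μ t))‖ ^ ((2 * (m : ℝ) + 1) / m)

/-- The cuspidal torsion `κ_t` along `μ`. -/
def cuspidalTorsion (m : ℕ) (f : ℝ × ℝ → E3) (ξ η : ℝ × ℝ → ℝ × ℝ) (μ : ℝ → ℝ × ℝ)
    (t : ℝ) : ℝ :=
  det3 (dirD ξ f (μ t)) ((dirD η)^[m] f (μ t)) (dirD ξ ((dirD η)^[m] f) (μ t))
      / ‖cross3 (dirD ξ f (μ t)) ((dirD η)^[m] f (μ t))‖ ^ 2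
    - det3 (dirD ξ f (μ t)) ((dirD η)^[m] f (μ t)) (dirD ξ (dirD ξ f) (μ t))
        * inner ℝ (dirD ξ f (μ t)) ((dirD η)^[m] f (μ t))
      / (‖dirD ξ f (μ t)‖ ^ 2 * ‖cross3 (dirD ξ f (μ t)) ((dirD η)^[m] f (μ t))‖ ^ 2)

/-- `Θ`, with inverse germ `Θinv`, is a positive coordinate system `(u, v)` of the source which,
together with the rotation `A`, brings `f` to the normal form of an `m`-type edge. -/
structure IsNormalFormChart (m : ℕ) (f : ℝ × ℝ → E3)
    (A : Matrix.specialOrthogonalGroup (Fin 3) ℝ) (Θ Θinv : ℝ × ℝ → ℝ × ℝ) : Prop where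
  diffeo : IsDiffeoGerm Θ Θinv
  positive : 0 < (fderiv ℝ Θ 0).det
  normal_form : ∃ (a b₀ : ℝ → ℝ) (b : ℝ × ℝ → ℝ),
    SmoothGerm a 0 ∧ SmoothGerm b₀ 0 ∧ SmoothGerm b 0 ∧ b 0 = 0 ∧
    ∀ᶠ q in 𝓝 (0 : ℝ × ℝ),
      (A : Matrix (Fin 3) (Fin 3) ℝ) *ᵥ (f (Θinv q)).ofLp =
        ![q.1,
          q.1 ^ 2 * a q.1 / 2 + q.2 ^ m / (m ! : ℝ),
          q.1 ^ 2 * b₀ q.1 / 2 + q.2 ^ m / (m ! : ℝ) * b q]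

/-- `γt` is the curve `γ` written in the coordinates `Θ = (u, v)` and reparametrized by `v`
(so that it is oriented in the direction of `v`). -/
def IsNormalParam (Θ : ℝ × ℝ → ℝ × ℝ) (γ γt : ℝ → ℝ × ℝ) : Prop :=
  ∃ s sinv : ℝ → ℝ, IsDiffeoGerm s sinv ∧
    ∀ᶠ t in 𝓝 0, Θ (γ (s t)) = γt t ∧ (γt t).2 = t

/-- The curvature of a curve in the Euclidean `(u, v)`-plane. -/
def planarCurvature (c : ℝ → ℝ × ℝ) (t : ℝ) : ℝ :=
  (deriv (fun r => (c r).1) t * iteratedDeriv 2 (fun r => (c r).2) t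
      - deriv (fun r => (c r).2) t * iteratedDeriv 2 (fun r => (c r).1) t)
    / (deriv (fun r => (c r).1) t ^ 2 + deriv (fun r => (c r).2) t ^ 2) ^ (3 / 2 : ℝ)

/-- The order at `0` of a smooth function-germ of one variable: the least `k` such that the
`k`-th derivative does not vanish at `0`, and `⊤` for a flat germ. -/
def germOrder (g : ℝ → ℝ) : ℕ∞ :=
  ⨅ (k : ℕ) (_ : iteratedDeriv k g 0 ≠ 0), (k : ℕ∞)

/-- `h : (ℝ ∖ {0}, 0) → ℝ` has rational order `o`: near `0`, `h = g₁ / (|g₂| g₃)` with smooth germs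
such that `g₂, g₃` have finite order, and `o = ord g₁ - ord g₂ - ord g₃`
(`o = ⊤` if `g₁` is flat). -/
def HasRationalOrder (h : ℝ → ℝ) (o : WithTop ℤ) : Prop :=
  ∃ g₁ g₂ g₃ : ℝ → ℝ, SmoothGerm g₁ 0 ∧ SmoothGerm g₂ 0 ∧ SmoothGerm g₃ 0 ∧
    (∀ᶠ t in 𝓝[≠] 0, h t = g₁ t / (|g₂ t| * g₃ t)) ∧
    ∃ n₂ n₃ : ℕ, germOrder g₂ = n₂ ∧ germOrder g₃ = n₃ ∧
      ((germOrder g₁ = ⊤ ∧ o = ⊤) ∨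
        ∃ n₁ : ℕ, germOrder g₁ = n₁ ∧ o = (((n₁ : ℤ) - n₂ - n₃ : ℤ) : WithTop ℤ))

/-- The geodesic curvature of `f ∘ γ` with respect to the unit normal `ν`. -/
def geodesicCurvature (f ν : ℝ × ℝ → E3) (γ : ℝ → ℝ × ℝ) (t : ℝ) : ℝ :=
  det3 (deriv (f ∘ γ) t) (iteratedDeriv 2 (f ∘ γ) t) (ν (γ t)) / ‖deriv (f ∘ γ) t‖ ^ 3

/-- The normal curvature of `f ∘ γ`. -/
def normalCurvature (f ν : ℝ × ℝ → E3) (γ : ℝ → ℝ × ℝ) (t : ℝ) : ℝ :=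
  inner ℝ (iteratedDeriv 2 (f ∘ γ) t) (ν (γ t)) / ‖deriv (f ∘ γ) t‖ ^ 2

/-- The geodesic torsion of `f ∘ γ`. -/
def geodesicTorsion (f ν : ℝ × ℝ → E3) (γ : ℝ → ℝ × ℝ) (t : ℝ) : ℝ :=
  det3 (deriv (f ∘ γ) t) (ν (γ t)) (deriv (ν ∘ γ) t) / ‖deriv (f ∘ γ) t‖ ^ 2

end

-- Everything is computed in the normal form `g`. Its partial derivatives are `g_u = (1, α, β)` and
-- `g_v = v (0, 1, B)`, where `α` and `β` vanish at the origin and `B = b + v b_v / 2`. Hence `N =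
-- (αB - β, -B, 1)` is a normal direction that stays nonzero on the singular set, and `ν` is a
-- nonvanishing multiple of it up to the rotation.
--
-- Write `x = t² X` and `y = 2X + t X'`, so that `x' = t y`. The image curve then has velocity `t w`
-- with `w = (y, 1 + yα, yβ + B)`, and `w` never vanishes. Consequently `κ_g`, `κ_n` and `τ_g` are,
-- up to nonvanishing smooth factors, `det(w, w', N) / |t|`, `⟨w', N⟩ / t` and `det(w, N, N') / t`
-- (`curvatures_eq`, `exists_curvatures_eq`). The orders reduce to those of three smooth numerators.
--
-- Along the curve `α = t² α₂`, `β = t² β₂`, `B = t B₁`, with `β₂(0) = X(0) b₀(0) + b_u(0)/2` and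
-- `B₁(0) = 3 b_v(0)/2`. The leading terms of the numerators are governed by `-y' - B'β`, `B'` and
-- `y B' - β'`. Since `y` has order `l - 2`, the cases in the theorem record which of these
-- competing terms has the lowest order.
--
-- Two facts translate the coefficients. First, `κ_t(0) = b_u(0)` and `ω_{2,3}(0) = 3 b_v(0)`
-- (`cuspidal_invariants`); the curvature of the plane curve supplies the Taylor coefficients of
-- `x`. Second, `b_v(0) ≠ 0`, because otherwise `f` would not be a cuspidal edge (`fderiv_ne_zero`);
-- this gives `ord κ_n = -1` for every `l`.

attribute [fun_prop] SmoothGerm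

/-! ### Closure properties of smooth germs -/

namespace SmoothGerm

variable {E F G : Type*} [NormedAddCommGroup E] [NormedSpace ℝ E]
  [NormedAddCommGroup F] [NormedSpace ℝ F] [NormedAddCommGroup G] [NormedSpace ℝ G] {x : E}

theorem contDiffAt {f : E → F} (hf : SmoothGerm f x) : ContDiffAt ℝ ∞ f x := hf.self_of_nhds

theorem differentiableAt {f : E → F} (hf : SmoothGerm f x) : DifferentiableAt ℝ f x :=
  hf.contDiffAt.differentiableAt (by simp)

theorem continuousAt {f : E → F} (hf : SmoothGerm f x) : ContinuousAt f x :=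
  hf.contDiffAt.continuousAt

theorem eventually_differentiableAt {f : E → F} (hf : SmoothGerm f x) :
    ∀ᶠ y in 𝓝 x, DifferentiableAt ℝ f y :=
  hf.mono fun _ h => h.differentiableAt (by simp)

theorem congr {f g : E → F} (hf : SmoothGerm f x) (h : g =ᶠ[𝓝 x] f) : SmoothGerm g x := by
  filter_upwards [hf, h.eventuallyEq_nhds] with y h1 h2 using h1.congr_of_eventuallyEq h2

theorem of_contDiff {f : E → F} (hf : ContDiff ℝ ∞ f) : SmoothGerm f x :=
  Eventually.of_forall fun _ => hf.contDiffAt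

@[fun_prop] theorem id : SmoothGerm (fun y : E => y) x := of_contDiff contDiff_id

@[fun_prop] theorem const (c : F) : SmoothGerm (fun _ : E => c) x := of_contDiff contDiff_const

@[fun_prop] theorem comp {g : F → G} {f : E → F} (hg : SmoothGerm g (f x)) (hf : SmoothGerm f x) :
    SmoothGerm (fun y => g (f y)) x := by
  filter_upwards [hf, hf.continuousAt.eventually hg] with y h1 h2 using h2.comp y h1

@[fun_prop] theorem add {f g : E → F} (hf : SmoothGerm f x) (hg : SmoothGerm g x) :
    SmoothGerm (fun y => f y + g y) x := by
  filter_upwards [hf, hg] with y h1 h2 using h1.add h2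

@[fun_prop] theorem sub {f g : E → F} (hf : SmoothGerm f x) (hg : SmoothGerm g x) :
    SmoothGerm (fun y => f y - g y) x := by
  filter_upwards [hf, hg] with y h1 h2 using h1.sub h2

@[fun_prop] theorem neg {f : E → F} (hf : SmoothGerm f x) : SmoothGerm (fun y => -f y) x := by
  filter_upwards [hf] with y h1 using h1.neg

@[fun_prop] theorem mul {f g : E → ℝ} (hf : SmoothGerm f x) (hg : SmoothGerm g x) :
    SmoothGerm (fun y => f y * g y) x := by
  filter_upwards [hf, hg] with y h1 h2 using h1.mul h2

@[fun_prop] theorem smul {f : E → ℝ} {g : E → F} (hf : SmoothGerm f x) (hg : SmoothGerm g x) :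
    SmoothGerm (fun y => f y • g y) x := by
  filter_upwards [hf, hg] with y h1 h2 using h1.smul h2

@[fun_prop] theorem pow {f : E → ℝ} (hf : SmoothGerm f x) (n : ℕ) :
    SmoothGerm (fun y => f y ^ n) x := by
  filter_upwards [hf] with y h1 using h1.pow n

@[fun_prop] theorem div_const {f : E → ℝ} (hf : SmoothGerm f x) (c : ℝ) :
    SmoothGerm (fun y => f y / c) x := by
  filter_upwards [hf] with y h1 using h1.div_const c

@[fun_prop] theorem fst {f : E → F × G} (hf : SmoothGerm f x) :
    SmoothGerm (fun y => (f y).1) x := by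
  filter_upwards [hf] with y h1 using h1.fst

@[fun_prop] theorem snd {f : E → F × G} (hf : SmoothGerm f x) :
    SmoothGerm (fun y => (f y).2) x := by
  filter_upwards [hf] with y h1 using h1.snd

@[fun_prop] theorem prodMk {f : E → F} {g : E → G} (hf : SmoothGerm f x) (hg : SmoothGerm g x) :
    SmoothGerm (fun y => (f y, g y)) x := by
  filter_upwards [hf, hg] with y h1 h2 using h1.prodMk h2

theorem div {f g : E → ℝ} (hf : SmoothGerm f x) (hg : SmoothGerm g x) (h0 : g x ≠ 0) :
    SmoothGerm (fun y => f y / g y) x := by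
  filter_upwards [hf, hg, hg.continuousAt.eventually_ne h0] with y h1 h2 h3 using h1.div h2 h3

theorem rpow_const {f : E → ℝ} (hf : SmoothGerm f x) (h0 : f x ≠ 0) (r : ℝ) :
    SmoothGerm (fun y => f y ^ r) x := by
  filter_upwards [hf, hf.continuousAt.eventually_ne h0] with y h1 h2
    using h1.rpow_const_of_ne h2

theorem abs {f : E → ℝ} (hf : SmoothGerm f x) (h0 : f x ≠ 0) :
    SmoothGerm (fun y => |f y|) x := by
  filter_upwards [hf, hf.continuousAt.eventually_ne h0] with y h1 h2 using h1.abs h2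

theorem fderiv {f : E → F} (hf : SmoothGerm f x) : SmoothGerm (fderiv ℝ f) x := by
  filter_upwards [hf] with y h1 using h1.fderiv_right (by simp)

@[fun_prop] theorem clm_apply {f : E → F →L[ℝ] G} {g : E → F} (hf : SmoothGerm f x)
    (hg : SmoothGerm g x) : SmoothGerm (fun y => f y (g y)) x := by
  filter_upwards [hf, hg] with y h1 h2 using h1.clm_apply h2

@[fun_prop] theorem fderiv_apply {f : E → F} {g : E → E} (hf : SmoothGerm f x)
    (hg : SmoothGerm g x) : SmoothGerm (fun y => _root_.fderiv ℝ f y (g y)) x :=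
  hf.fderiv.clm_apply hg

theorem deriv {f : ℝ → F} {t : ℝ} (hf : SmoothGerm f t) : SmoothGerm (deriv f) t := by
  filter_upwards [hf] with y h1 using h1.derivWithin (by simp)

theorem apply_euclidean {ι : Type*} [Fintype ι] {f : E → EuclideanSpace ℝ ι} (hf : SmoothGerm f x)
    (i : ι) : SmoothGerm (fun y => f y i) x := by
  filter_upwards [hf] with y h1 using contDiffAt_euclidean.1 h1 i

theorem hasDerivAt {f : ℝ → F} {t : ℝ} (hf : SmoothGerm f t) : HasDerivAt f (_root_.deriv f t) t :=
  hf.differentiableAt.hasDerivAt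

theorem eventually_hasDerivAt {f : ℝ → F} {t : ℝ} (hf : SmoothGerm f t) :
    ∀ᶠ y in 𝓝 t, HasDerivAt f (_root_.deriv f y) y :=
  hf.eventually_differentiableAt.mono fun _ h => h.hasDerivAt

end SmoothGerm

/-! ### Division of a smooth germ by the variable -/

section Hadamard

open MeasureTheory

/-- Differentiation under the integral sign. The weight `s ^ j` is there because each
differentiation produces one more factor `s`, so the family is closed under it and smoothness
follows by induction. -/
theorem hasDerivAt_integral_pow_mul_comp_mul {F : ℝ → ℝ} (hF : ContDiff ℝ 1 F) (j : ℕ) (t : ℝ) :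
    HasDerivAt (fun t => ∫ s in (0 : ℝ)..1, s ^ j * F (s * t))
      (∫ s in (0 : ℝ)..1, s ^ (j + 1) * deriv F (s * t)) t := by
  have hd : Continuous (deriv F) := hF.continuous_deriv (by simp)
  obtain ⟨C, hC⟩ : ∃ C, ∀ y ∈ Metric.closedBall (0 : ℝ) (|t| + 1), ‖deriv F y‖ ≤ C :=
    (isCompact_closedBall _ _).exists_bound_of_continuousOn hd.continuousOn
  have hc := hF.continuous
  refine (intervalIntegral.hasDerivAt_integral_of_dominated_loc_of_deriv_le
    (F := fun t s => s ^ j * F (s * t)) (F' := fun t s => s ^ (j + 1) * deriv F (s * t))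
    (bound := fun _ => C) (Metric.ball_mem_nhds t one_pos) ?_ ?_ ?_ ?_ ?_ ?_).2
  · exact Eventually.of_forall fun y => (by fun_prop : Continuous _).aestronglyMeasurable
  · exact (by fun_prop : Continuous _).intervalIntegrable _ _
  · exact (by fun_prop : Continuous _).aestronglyMeasurable
  · refine Eventually.of_forall fun s hs y hy => ?_
    rw [Set.uIoc_of_le zero_le_one] at hs
    have h1 : ‖s ^ (j + 1)‖ ≤ 1 := by
      rw [norm_pow, Real.norm_of_nonneg hs.1.le]
      exact pow_le_one₀ hs.1.le hs.2
    have h2 : ‖deriv F (s * y)‖ ≤ C := by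
      apply hC
      rw [mem_closedBall_zero_iff, norm_mul, Real.norm_of_nonneg hs.1.le, Real.norm_eq_abs]
      have h3 : |y| ≤ |t| + 1 := by
        have := abs_sub_abs_le_abs_sub y t
        rw [Metric.mem_ball, Real.dist_eq] at hy
        linarith
      nlinarith [abs_nonneg y, hs.1, hs.2]
    rw [norm_mul]
    calc _ ≤ 1 * C := mul_le_mul h1 h2 (norm_nonneg _) zero_le_one
      _ = C := one_mul C
  · simp
  · refine Eventually.of_forall fun s _ y _ => ?_
    have h1 : HasDerivAt (fun y => s * y) s y := by simpa using (hasDerivAt_id y).const_mul s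
    have h2 := ((hF.differentiable (by simp) (s * y)).hasDerivAt.comp y h1).const_mul (s ^ j)
    exact h2.congr_deriv (by ring)

theorem contDiff_integral_pow_mul_comp_mul {F : ℝ → ℝ} (hF : ContDiff ℝ ∞ F) (j : ℕ) :
    ContDiff ℝ ∞ (fun t => ∫ s in (0 : ℝ)..1, s ^ j * F (s * t)) := by
  refine contDiff_infty.2 fun n => ?_
  induction n generalizing F j with
  | zero =>
    exact contDiff_zero.2 (continuous_iff_continuousAt.2 fun t =>
      (hasDerivAt_integral_pow_mul_comp_mul (hF.of_le (by simp)) j t).continuousAt)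
  | succ n ih =>
    have h := hasDerivAt_integral_pow_mul_comp_mul (hF.of_le (by simp)) j
    refine (contDiff_succ_iff_deriv (n := (n : WithTop ℕ∞))).2
      ⟨fun t => (h t).differentiableAt, by simp, ?_⟩
    rw [deriv_eq h]
    exact ih (contDiff_infty_iff_deriv.1 hF).2 (j + 1)

/-- A bump function supported where `f` is smooth makes the germ global, as required by the integral
formula behind Hadamard's lemma. -/
theorem SmoothGerm.exists_contDiff_eventuallyEq {f : ℝ → ℝ} {x : ℝ} (hf : SmoothGerm f x) :
    ∃ g : ℝ → ℝ, ContDiff ℝ ∞ g ∧ g =ᶠ[𝓝 x] f := by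
  obtain ⟨r, hr, h⟩ := Metric.eventually_nhds_iff_ball.1 hf
  let χ : ContDiffBump x := ⟨r / 4, r / 2, by positivity, by linarith⟩
  refine ⟨fun y => χ y * f y, ?_, ?_⟩
  · refine contDiff_iff_contDiffAt.2 fun y => ?_
    by_cases hy : y ∈ Metric.ball x r
    · exact χ.contDiff.contDiffAt.mul (h y hy)
    · have : (fun y => χ y * f y) =ᶠ[𝓝 y] fun _ => 0 := by
        have : y ∉ tsupport χ := by
          rw [χ.tsupport_eq]
          intro h'
          rw [Metric.mem_closedBall] at h'
          rw [Metric.mem_ball] at hy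
          have h'' : dist y x ≤ r / 2 := h'
          linarith
        filter_upwards [notMem_tsupport_iff_eventuallyEq.1 this] with z hz
        simp [hz]
      exact contDiffAt_const.congr_of_eventuallyEq this
  · filter_upwards [χ.eventuallyEq_one] with y hy
    simp [hy]

/-- Hadamard's lemma in one variable. -/
theorem SmoothGerm.exists_eq_mul {f : ℝ → ℝ} (hf : SmoothGerm f 0) (h0 : f 0 = 0) :
    ∃ g : ℝ → ℝ, SmoothGerm g 0 ∧ ∀ᶠ t in 𝓝 0, f t = t * g t := by
  obtain ⟨F, hF, hFf⟩ := hf.exists_contDiff_eventuallyEq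
  have hF0 : F 0 = 0 := by rw [hFf.eq_of_nhds, h0]
  have hd : ContDiff ℝ ∞ (_root_.deriv F) := (contDiff_infty_iff_deriv.1 hF).2
  refine ⟨_, .of_contDiff (contDiff_integral_pow_mul_comp_mul hd 0), ?_⟩
  filter_upwards [hFf] with t ht
  -- The quotient is the integral of `F'(s t)` over `s` in `[0, 1]`; substitution and the
  -- fundamental theorem of calculus turn `t` times it into `F t - F 0`.
  have h1 := intervalIntegral.smul_integral_comp_mul_right (a := 0) (b := 1) (_root_.deriv F) t
  rw [intervalIntegral.integral_eq_sub_of_hasDerivAt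
    (fun x _ => (hF.differentiable (by simp) x).hasDerivAt)
    (hd.continuous.intervalIntegrable _ _)] at h1
  simp only [smul_eq_mul, one_mul, zero_mul, hF0, sub_zero] at h1
  simp only [pow_zero, one_mul]
  rw [h1, ht]

end Hadamard

/-! ### Orders of germs from factorizations `t ^ n * z` -/

section Order

/-- Differentiating `t ^ (n + 1) * z` gives `t ^ n * ((n + 1) z + t z')`, again of the same shape,
so induction replaces the Leibniz formula. -/
theorem iteratedDeriv_pow_mul {z : ℝ → ℝ} (hz : SmoothGerm z 0) (n : ℕ) :
    (∀ k < n, iteratedDeriv k (fun t => t ^ n * z t) 0 = 0) ∧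
      iteratedDeriv n (fun t => t ^ n * z t) 0 = n ! * z 0 := by
  induction n generalizing z with
  | zero => simp
  | succ n ih =>
    have hd : deriv (fun t => t ^ (n + 1) * z t)
        =ᶠ[𝓝 0] fun t => t ^ n * ((n + 1) * z t + t * deriv z t) := by
      filter_upwards [hz.eventually_hasDerivAt] with t ht
      rw [((hasDerivAt_pow (n + 1) t).fun_mul ht).deriv]
      push_cast
      ring
    have hz' := hz.deriv
    obtain ⟨h1, h2⟩ := ih (z := fun t => (n + 1) * z t + t * deriv z t) (by fun_prop)
    constructor
    · rintro (_ | k) hk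
      · simp
      · rw [iteratedDeriv_succ', hd.iteratedDeriv_eq]
        exact h1 k (by omega)
    · rw [iteratedDeriv_succ', hd.iteratedDeriv_eq, h2]
      push_cast [Nat.factorial_succ]
      ring

theorem SmoothGerm.exists_eq_pow_mul {f : ℝ → ℝ} (hf : SmoothGerm f 0) (n : ℕ)
    (h : ∀ k < n, iteratedDeriv k f 0 = 0) :
    ∃ g : ℝ → ℝ, SmoothGerm g 0 ∧ f =ᶠ[𝓝 0] fun t => t ^ n * g t := by
  induction n with
  | zero => exact ⟨f, hf, by simp⟩
  | succ n ih =>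
    obtain ⟨g, hg, hfg⟩ := ih fun k hk => h k (by omega)
    have h0 : g 0 = 0 := by
      have h1 := h n (by omega)
      rw [hfg.iteratedDeriv_eq, (iteratedDeriv_pow_mul hg n).2] at h1
      simpa [Nat.factorial_ne_zero] using h1
    obtain ⟨g', hg', hgg⟩ := hg.exists_eq_mul h0
    refine ⟨g', hg', ?_⟩
    filter_upwards [hfg, hgg] with t h1 h2
    rw [h1, h2, pow_succ, mul_assoc]

theorem natCast_le_germOrder_iff {g : ℝ → ℝ} {n : ℕ} :
    (n : ℕ∞) ≤ germOrder g ↔ ∀ k < n, iteratedDeriv k g 0 = 0 := by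
  simp only [germOrder, le_iInf_iff, Nat.cast_le]
  constructor
  · intro h k hk
    by_contra h'
    exact absurd (h k h') (by omega)
  · intro h k hk
    by_contra h'
    exact hk (h k (by omega))

theorem germOrder_eq_natCast_iff {g : ℝ → ℝ} {n : ℕ} :
    germOrder g = n ↔ (∀ k < n, iteratedDeriv k g 0 = 0) ∧ iteratedDeriv n g 0 ≠ 0 := by
  rw [← natCast_le_germOrder_iff]
  constructor
  · intro h
    refine ⟨h.ge, fun h0 => ?_⟩
    have h1 : ((n + 1 : ℕ) : ℕ∞) ≤ germOrder g := by
      refine natCast_le_germOrder_iff.2 fun k hk => ?_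
      rcases Nat.lt_succ_iff_lt_or_eq.1 hk with h2 | rfl
      · exact natCast_le_germOrder_iff.1 h.ge k h2
      · exact h0
    rw [h, Nat.cast_le] at h1
    omega
  · rintro ⟨h1, h2⟩
    exact le_antisymm (iInf₂_le n h2) h1

theorem natCast_le_germOrder_of_eq {g z : ℝ → ℝ} {n : ℕ} (hz : SmoothGerm z 0)
    (h : g =ᶠ[𝓝 0] fun t => t ^ n * z t) : (n : ℕ∞) ≤ germOrder g :=
  natCast_le_germOrder_iff.2 fun k hk => by
    rw [h.iteratedDeriv_eq, (iteratedDeriv_pow_mul hz n).1 k hk]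

theorem germOrder_eq_natCast_iff_of_eq {g z : ℝ → ℝ} {n : ℕ} (hz : SmoothGerm z 0)
    (h : g =ᶠ[𝓝 0] fun t => t ^ n * z t) : germOrder g = n ↔ z 0 ≠ 0 := by
  rw [germOrder_eq_natCast_iff, h.iteratedDeriv_eq, (iteratedDeriv_pow_mul hz n).2,
    ← natCast_le_germOrder_iff, and_iff_right (natCast_le_germOrder_of_eq hz h)]
  simp [Nat.factorial_ne_zero]

/-- A factor `t ^ k` in the numerator only bounds the order from below, and the bound is attained
exactly when the cofactor is nonzero at `0`. The numerator may be flat, in which case the order is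
`⊤`. -/
theorem exists_hasRationalOrder {h g₁ g₂ g₃ z : ℝ → ℝ} {k n₂ n₃ : ℕ}
    (h₁ : SmoothGerm g₁ 0) (h₂ : SmoothGerm g₂ 0) (h₃ : SmoothGerm g₃ 0)
    (hh : ∀ᶠ t in 𝓝[≠] 0, h t = g₁ t / (|g₂ t| * g₃ t))
    (ho₂ : germOrder g₂ = n₂) (ho₃ : germOrder g₃ = n₃)
    (hz : SmoothGerm z 0) (hgz : g₁ =ᶠ[𝓝 0] fun t => t ^ k * z t) :
    ∃ o, HasRationalOrder h o ∧ (((k : ℤ) - n₂ - n₃ : ℤ) : WithTop ℤ) ≤ o ∧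
      (o = (((k : ℤ) - n₂ - n₃ : ℤ) : WithTop ℤ) ↔ z 0 ≠ 0) := by
  have hle := natCast_le_germOrder_of_eq hz hgz
  have hiff := germOrder_eq_natCast_iff_of_eq hz hgz
  by_cases ht : germOrder g₁ = ⊤
  · refine ⟨⊤, ⟨g₁, g₂, g₃, h₁, h₂, h₃, hh, n₂, n₃, ho₂, ho₃, Or.inl ⟨ht, rfl⟩⟩, le_top, ?_⟩
    rw [← hiff, ht]
    exact iff_of_false (WithTop.coe_ne_top).symm (ENat.natCast_ne_top k).symm
  · obtain ⟨n₁, hn₁⟩ := ENat.ne_top_iff_exists.1 ht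
    refine ⟨(((n₁ : ℤ) - n₂ - n₃ : ℤ) : WithTop ℤ),
      ⟨g₁, g₂, g₃, h₁, h₂, h₃, hh, n₂, n₃, ho₂, ho₃, Or.inr ⟨n₁, hn₁.symm, rfl⟩⟩, ?_, ?_⟩
    · rw [← hn₁, Nat.cast_le] at hle
      rw [WithTop.coe_le_coe]
      omega
    · rw [← hiff, ← hn₁, WithTop.coe_inj, Nat.cast_inj]
      omega

end Order

/-! ### Determinants, vector products and rotations of three-space -/

theorem inner_eq_sum_three (x y : E3) : inner ℝ x y = x 0 * y 0 + x 1 * y 1 + x 2 * y 2 := by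
  simp [PiLp.inner_apply, Fin.sum_univ_three, mul_comm]

theorem det3_eq (x y z : E3) : det3 x y z =
    x 0 * (y 1 * z 2 - y 2 * z 1) - x 1 * (y 0 * z 2 - y 2 * z 0)
      + x 2 * (y 0 * z 1 - y 1 * z 0) := by
  simp [det3, Matrix.det_fin_three]
  ring

theorem cross3_apply (x y : E3) : cross3 x y 0 = x 1 * y 2 - x 2 * y 1 ∧
    cross3 x y 1 = x 2 * y 0 - x 0 * y 2 ∧ cross3 x y 2 = x 0 * y 1 - x 1 * y 0 := by
  simp [cross3, crossProduct]

/-- Lagrange's identity: the norm depends on inner products only, so every linear isometry preserves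
it. -/
theorem norm_cross3 (x y : E3) :
    ‖cross3 x y‖ = √(inner ℝ x x * inner ℝ y y - inner ℝ x y ^ 2) := by
  obtain ⟨h0, h1, h2⟩ := cross3_apply x y
  rw [norm_eq_sqrt_real_inner]
  congr 1
  simp only [inner_eq_sum_three, h0, h1, h2]
  ring

/-- The linear isometry of `ℝ³` given by a rotation matrix. -/
noncomputable def rotationIsometry (A : Matrix.specialOrthogonalGroup (Fin 3) ℝ) : E3 ≃ₗᵢ[ℝ] E3 :=
  { toFun := fun x => WithLp.toLp 2 ((A : Matrix (Fin 3) (Fin 3) ℝ) *ᵥ x.ofLp)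
    invFun := fun x => WithLp.toLp 2 ((A : Matrix (Fin 3) (Fin 3) ℝ)ᵀ *ᵥ x.ofLp)
    map_add' := fun x y => by simp [Matrix.mulVec_add]
    map_smul' := fun c x => by simp [Matrix.mulVec_smul]
    left_inv := fun x => by
      have h := ((Matrix.mem_specialOrthogonalGroup_iff).1 A.2).1
      simp [Matrix.mulVec_mulVec, (Matrix.mem_orthogonalGroup_iff' (Fin 3) ℝ).1 h]
    right_inv := fun x => by
      have h := ((Matrix.mem_specialOrthogonalGroup_iff).1 A.2).1
      simp [Matrix.mulVec_mulVec, (Matrix.mem_orthogonalGroup_iff (Fin 3) ℝ).1 h]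
    norm_map' := fun x => by
      have h := ((Matrix.mem_specialOrthogonalGroup_iff).1 A.2).1
      have h' := (Matrix.mem_orthogonalGroup_iff' (Fin 3) ℝ).1 h
      rw [norm_eq_sqrt_real_inner, norm_eq_sqrt_real_inner]
      congr 1
      simp only [EuclideanSpace.inner_eq_star_dotProduct, LinearEquiv.coe_mk, LinearMap.coe_mk,
        AddHom.coe_mk, star_trivial]
      rw [Matrix.dotProduct_mulVec, Matrix.vecMul_mulVec, ← Matrix.dotProduct_mulVec]
      simp_all }

theorem det3_rotationIsometry (A : Matrix.specialOrthogonalGroup (Fin 3) ℝ) (x y z : E3) :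
    det3 (rotationIsometry A x) (rotationIsometry A y) (rotationIsometry A z) = det3 x y z := by
  have h : det3 (rotationIsometry A x) (rotationIsometry A y) (rotationIsometry A z) =
      Matrix.det ((A : Matrix (Fin 3) (Fin 3) ℝ) *
        !![x 0, y 0, z 0; x 1, y 1, z 1; x 2, y 2, z 2]) := by
    rw [det3]
    congr 1
    ext i j
    fin_cases i <;> fin_cases j <;>
      simp [rotationIsometry, Matrix.mul_apply, Fin.sum_univ_three, Matrix.mulVec, dotProduct]
  rw [h, Matrix.det_mul, ((Matrix.mem_specialOrthogonalGroup_iff).1 A.2).2, one_mul, det3]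

theorem norm_cross3_linearIsometry (L : E3 ≃ₗᵢ[ℝ] E3) (x y : E3) :
    ‖cross3 (L x) (L y)‖ = ‖cross3 x y‖ := by
  simp only [norm_cross3, L.inner_map_map]

/-! ### The normal form, and nonvanishing of `b_v(0)` -/

/-- The normal form of a cuspidal edge. -/
noncomputable def edgeNormalForm (a b₀ : ℝ → ℝ) (b : ℝ × ℝ → ℝ) (q : ℝ × ℝ) : E3 :=
  !₂[q.1, q.1 ^ 2 * a q.1 / 2 + q.2 ^ 2 / 2, q.1 ^ 2 * b₀ q.1 / 2 + q.2 ^ 2 / 2 * b q]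

/-- The germ `f` is, up to the positive coordinate change `Θ` and the rotation `L`, in normal
form with coefficients `a`, `b₀`, `b`. -/
structure EdgeNormalized (f : ℝ × ℝ → E3) (L : E3 ≃ₗᵢ[ℝ] E3) (Θ Θinv : ℝ × ℝ → ℝ × ℝ)
    (a b₀ : ℝ → ℝ) (b : ℝ × ℝ → ℝ) : Prop where
  det3_map : ∀ x y z : E3, det3 (L x) (L y) (L z) = det3 x y z
  diffeo : IsDiffeoGerm Θ Θinv
  positive : 0 < (fderiv ℝ Θ 0).det
  smooth_a : SmoothGerm a 0
  smooth_b₀ : SmoothGerm b₀ 0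
  smooth_b : SmoothGerm b 0
  b_zero : b 0 = 0
  eq_comp : f =ᶠ[𝓝 0] fun p => L (edgeNormalForm a b₀ b (Θ p))

theorem IsNormalFormChart.exists_edgeNormalized {f : ℝ × ℝ → E3}
    {A : Matrix.specialOrthogonalGroup (Fin 3) ℝ} {Θ Θinv : ℝ × ℝ → ℝ × ℝ}
    (h : IsNormalFormChart 2 f A Θ Θinv) :
    ∃ (L : E3 ≃ₗᵢ[ℝ] E3) (a b₀ : ℝ → ℝ) (b : ℝ × ℝ → ℝ), EdgeNormalized f L Θ Θinv a b₀ b := by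
  obtain ⟨a, b₀, b, ha, hb₀, hb, hb0, hf⟩ := h.normal_form
  refine ⟨(rotationIsometry A).symm, a, b₀, b, fun x y z => ?_, h.diffeo, h.positive, ha, hb₀, hb,
    hb0, ?_⟩
  · rw [← det3_rotationIsometry A]
    simp
  · have hc : Tendsto Θ (𝓝 0) (𝓝 0) := by
      have := h.diffeo.smooth.continuousAt.tendsto
      rwa [h.diffeo.map_zero] at this
    filter_upwards [hc.eventually hf, h.diffeo.left_inv] with p hp hp'
    rw [LinearIsometryEquiv.eq_symm_apply]
    rw [hp'] at hp
    apply WithLp.ofLp_injective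
    change (A : Matrix (Fin 3) (Fin 3) ℝ) *ᵥ (f p).ofLp = _
    rw [hp]
    simp [edgeNormalForm, Nat.factorial]

theorem smoothGerm_toLp {E ι : Type*} [NormedAddCommGroup E] [NormedSpace ℝ E] [Fintype ι] {x : E}
    {g : E → ι → ℝ} (h : ∀ i, SmoothGerm (fun y => g y i) x) :
    SmoothGerm (fun y => (WithLp.toLp 2 (g y) : EuclideanSpace ℝ ι)) x := by
  filter_upwards [eventually_all.2 h] with y hy using contDiffAt_euclidean.2 hy

theorem smoothGerm_vec3 {E : Type*} [NormedAddCommGroup E] [NormedSpace ℝ E] {x : E}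
    {g₁ g₂ g₃ : E → ℝ} (h₁ : SmoothGerm g₁ x) (h₂ : SmoothGerm g₂ x) (h₃ : SmoothGerm g₃ x) :
    SmoothGerm (fun y => (!₂[g₁ y, g₂ y, g₃ y] : E3)) x := by
  refine smoothGerm_toLp fun i => ?_
  fin_cases i <;> assumption

theorem SmoothGerm.edgeNormalForm {a b₀ : ℝ → ℝ} {b : ℝ × ℝ → ℝ} (ha : SmoothGerm a 0)
    (hb₀ : SmoothGerm b₀ 0) (hb : SmoothGerm b 0) : SmoothGerm (edgeNormalForm a b₀ b) 0 := by
  have h1 : SmoothGerm (fun q : ℝ × ℝ => a q.1) 0 := SmoothGerm.comp (by exact ha) (by fun_prop)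
  have h2 : SmoothGerm (fun q : ℝ × ℝ => b₀ q.1) 0 := SmoothGerm.comp (by exact hb₀) (by fun_prop)
  refine smoothGerm_vec3 ?_ ?_ ?_ <;> fun_prop

theorem edgeNormalForm_zero (a b₀ : ℝ → ℝ) (b : ℝ × ℝ → ℝ) : edgeNormalForm a b₀ b 0 = 0 := by
  ext i
  fin_cases i <;> simp [edgeNormalForm]

/-- An odd-part estimate: the third-order part of `f ∘ c` is not flat along the null direction of a
cuspidal edge. -/
theorem EdgeNormalized.fderiv_ne_zero {f : ℝ × ℝ → E3} {L : E3 ≃ₗᵢ[ℝ] E3}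
    {Θ Θinv : ℝ × ℝ → ℝ × ℝ} {a b₀ : ℝ → ℝ} {b : ℝ × ℝ → ℝ}
    (h : EdgeNormalized f L Θ Θinv a b₀ b) (hf : IsCuspidalEdge f) :
    fderiv ℝ b 0 (0, 1) ≠ 0 := by
  -- Follow the `v`-axis of the normal form by the curve `c` in the source of `(u, v², v³)`. If
  -- `b_v(0) = 0`, the odd part of the normal form along the axis is `o(t³)`, and a Lipschitz target
  -- map carries this to `(c₁, c₂², c₂³)`. The first component then forces `c₁'(0) = 0` and the
  -- third forces `c₂'(0) = 0`, although `c` is regular.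
  intro hb0
  obtain ⟨Φs, Ψs, Φt, Ψt, hs, ht, hft⟩ := hf
  set c : ℝ → ℝ × ℝ := fun t => Ψs (Θinv (0, t)) with hc
  have hc0 : c 0 = 0 := by
    change Ψs (Θinv 0) = 0
    rw [h.diffeo.inv_zero, hs.inv_zero]
  have hι : SmoothGerm (fun t : ℝ => ((0 : ℝ), t)) 0 := by fun_prop
  have hΘι : SmoothGerm (fun t : ℝ => Θinv (0, t)) 0 := SmoothGerm.comp h.diffeo.smooth_inv hι
  have hcs : SmoothGerm c 0 := by
    refine SmoothGerm.comp ?_ hΘι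
    change SmoothGerm Ψs (Θinv 0)
    rw [h.diffeo.inv_zero]
    exact hs.smooth_inv
  have hct : Tendsto c (𝓝 0) (𝓝 0) := by
    have := hcs.continuousAt.tendsto
    rwa [hc0] at this
  have hΘt : Tendsto (fun t : ℝ => Θinv (0, t)) (𝓝 0) (𝓝 0) := by
    have := hΘι.continuousAt.tendsto
    change Tendsto _ _ (𝓝 (Θinv 0)) at this
    rwa [h.diffeo.inv_zero] at this
  have hιt : Tendsto (fun t : ℝ => ((0 : ℝ), t)) (𝓝 0) (𝓝 0) := hι.continuousAt.tendsto
  -- the velocity of `c` does not vanish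
  have hc' : deriv c 0 ≠ 0 := by
    intro h0
    have hd := hcs.hasDerivAt
    rw [h0] at hd
    have e1 : HasFDerivAt Φs (fderiv ℝ Φs 0) (c 0) := by
      rw [hc0]; exact hs.smooth.differentiableAt.hasFDerivAt
    have e2 : HasFDerivAt Θ (fderiv ℝ Θ 0) (Φs (c 0)) := by
      rw [hc0, hs.map_zero]; exact h.diffeo.smooth.differentiableAt.hasFDerivAt
    have e3 := e2.comp_hasDerivAt (0 : ℝ) (e1.comp_hasDerivAt (0 : ℝ) hd)
    simp only [map_zero] at e3
    have e4 : (fun t : ℝ => ((0 : ℝ), t)) =ᶠ[𝓝 0] Θ ∘ Φs ∘ c := by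
      filter_upwards [hΘt.eventually hs.right_inv, hιt.eventually h.diffeo.right_inv] with t h1 h2
      simp [hc, h1, h2]
    have e5 := (e3.congr_of_eventuallyEq e4).unique
      ((hasDerivAt_const (0 : ℝ) (0 : ℝ)).prodMk (hasDerivAt_id (0 : ℝ)))
    simpa using congrArg Prod.snd e5
  -- a Lipschitz bound
  have hK : SmoothGerm (fun y => Ψt (L y)) 0 := by
    refine SmoothGerm.comp ?_ (.of_contDiff L.contDiff)
    rw [map_zero]
    exact ht.smooth_inv
  obtain ⟨C, s, hsn, hC⟩ :=
    (hK.contDiffAt.of_le (by simp : (1 : WithTop ℕ∞) ≤ ∞)).exists_lipschitzOnWith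
  set G : ℝ → E3 := fun t => edgeNormalForm a b₀ b (0, t) with hG
  have hGt : Tendsto G (𝓝 0) (𝓝 0) := by
    have := (SmoothGerm.edgeNormalForm h.smooth_a h.smooth_b₀ h.smooth_b).continuousAt.tendsto
    rw [edgeNormalForm_zero] at this
    exact this.comp hιt
  have hfc : ∀ᶠ t in 𝓝 (0 : ℝ),
      (!₂[(c t).1, (c t).2 ^ 2, (c t).2 ^ 3] : E3) = Ψt (L (G t)) := by
    have h0 : Tendsto (fun q : ℝ × ℝ => (!₂[q.1, q.2 ^ 2, q.2 ^ 3] : E3)) (𝓝 0) (𝓝 0) := by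
      have : SmoothGerm (fun q : ℝ × ℝ => (!₂[q.1, q.2 ^ 2, q.2 ^ 3] : E3)) 0 :=
        smoothGerm_vec3 (by fun_prop) (by fun_prop) (by fun_prop)
      have h1 := this.continuousAt.tendsto
      have h2 : (!₂[(0 : ℝ × ℝ).1, (0 : ℝ × ℝ).2 ^ 2, (0 : ℝ × ℝ).2 ^ 3] : E3) = 0 := by
        ext i; fin_cases i <;> simp
      rwa [h2] at h1
    filter_upwards [hΘt.eventually hft, hΘt.eventually h.eq_comp,
      hιt.eventually h.diffeo.right_inv, (h0.comp hct).eventually ht.left_inv] with t h1 h2 h3 h4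
    rw [h3] at h2
    rw [hG]
    simp only
    rw [← h2, h1]
    exact h4.symm
  have hneg : Tendsto (fun t : ℝ => -t) (𝓝 0) (𝓝 0) := by
    simpa using (continuous_neg (G := ℝ)).tendsto 0
  -- the odd part of `G` is of order greater than three
  have hodd : Tendsto (fun t => (G t - G (-t)) 2 / t ^ 3) (𝓝[≠] 0) (𝓝 0) := by
    have hb1 : HasDerivAt (fun t : ℝ => b (0, t)) 0 0 := by
      have e := h.smooth_b.differentiableAt.hasFDerivAt.comp_hasDerivAt (0 : ℝ)
        (f := fun t : ℝ => ((0 : ℝ), t))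
        ((hasDerivAt_const (0 : ℝ) (0 : ℝ)).prodMk (hasDerivAt_id (0 : ℝ)))
      rwa [hb0] at e
    have hb2 : HasDerivAt (fun t : ℝ => (b (0, t) - b (0, -t)) / 2) 0 0 := by
      have e : HasDerivAt (fun t : ℝ => b (0, -t)) 0 0 := by
        have := HasDerivAt.comp (0 : ℝ) (h := fun t : ℝ => -t) (h₂ := fun t => b (0, t)) (h₂' := 0)
          (h' := -1) (by simpa using hb1) (hasDerivAt_neg (0 : ℝ))
        simpa [Function.comp_def] using this
      simpa using (hb1.sub e).div_const 2
    have h3 := hb2.tendsto_slope_zero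
    refine h3.congr' ?_
    filter_upwards [self_mem_nhdsWithin] with t ht
    have ht : t ≠ 0 := ht
    simp [hG, edgeNormalForm]
    field_simp
  have hdiff : ∀ᶠ t in 𝓝[≠] (0 : ℝ), ∀ i,
      |(!₂[(c t).1, (c t).2 ^ 2, (c t).2 ^ 3] - !₂[(c (-t)).1, (c (-t)).2 ^ 2, (c (-t)).2 ^ 3] :
        E3) i / t ^ 3| ≤ C * |(G t - G (-t)) 2 / t ^ 3| := by
    apply nhdsWithin_le_nhds
    filter_upwards [hfc, hneg.eventually hfc, hGt hsn, (hGt.comp hneg) hsn] with t h1 h2 h3 h4 i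
    rw [h1, h2, abs_div, abs_div, ← mul_div_assoc]
    -- The first two components of `G` are even in `t`, so the difference is carried by the third
    -- one alone.
    have h5 : |(G t - G (-t)) 2| = ‖G t - G (-t)‖ := by
      rw [EuclideanSpace.norm_eq, Fin.sum_univ_three]
      simp [hG, edgeNormalForm, Real.sqrt_sq_eq_abs]
    rw [h5]
    gcongr
    rw [← Real.norm_eq_abs]
    refine (PiLp.norm_apply_le (Ψt (L (G t)) - Ψt (L (G (-t)))) i).trans ?_
    simpa [dist_eq_norm] using hC.dist_le_mul _ h3 _ h4
  have hzero : ∀ i, Tendsto (fun t =>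
      (!₂[(c t).1, (c t).2 ^ 2, (c t).2 ^ 3] - !₂[(c (-t)).1, (c (-t)).2 ^ 2, (c (-t)).2 ^ 3] :
        E3) i / t ^ 3) (𝓝[≠] 0) (𝓝 0) := fun i =>
    squeeze_zero_norm' (hdiff.mono fun t ht => ht i) (by simpa using hodd.abs.const_mul (C : ℝ))
  have hsl := hcs.hasDerivAt.tendsto_slope_zero
  have hnegp : Tendsto (fun t : ℝ => -t) (𝓝[≠] 0) (𝓝[≠] 0) := by
    refine tendsto_nhdsWithin_iff.2 ⟨hneg.mono_left nhdsWithin_le_nhds, ?_⟩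
    filter_upwards [self_mem_nhdsWithin] with t ht using neg_ne_zero.2 ht
  have hsl' := hsl.comp hnegp
  simp only [zero_add, hc0, sub_zero, Function.comp_def] at hsl hsl'
  have f1 := (continuous_fst.tendsto _).comp hsl
  have f1' := (continuous_fst.tendsto _).comp hsl'
  have f2 := (continuous_snd.tendsto _).comp hsl
  have f2' := (continuous_snd.tendsto _).comp hsl'
  have g1 : (deriv c 0).1 = 0 := by
    have e := f1.add f1'
    have e0 : Tendsto (fun t : ℝ => t ^ 2) (𝓝[≠] 0) (𝓝 0) := by
      have : Tendsto (fun t : ℝ => t ^ 2) (𝓝 0) (𝓝 (0 ^ 2)) := (continuous_pow 2).tendsto 0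
      simpa using this.mono_left nhdsWithin_le_nhds
    have e' := (hzero 0).mul e0
    have := tendsto_nhds_unique (e'.congr' ?_) e
    · linarith
    · filter_upwards [self_mem_nhdsWithin] with t ht
      have ht : t ≠ 0 := ht
      simp
      field_simp
      ring
  have g2 : (deriv c 0).2 = 0 := by
    -- Since `c(-t) / (-t)` also tends to `c'(0)`, the sum of the cubes is `(c₂(t)³ - c₂(-t)³) / t³`
    -- and has limit `2 c₂'(0)³`.
    have e := (f2.pow 3).add (f2'.pow 3)
    have := tendsto_nhds_unique ((hzero 2).congr' ?_) e
    · have h3 : (deriv c 0).2 ^ 3 = 0 := by linarith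
      exact pow_eq_zero_iff (by norm_num) |>.1 h3
    · filter_upwards [self_mem_nhdsWithin] with t ht
      have ht : t ≠ 0 := ht
      simp
      field_simp
      ring
  exact hc' (Prod.ext g1 g2)

/-! ### Iterated derivatives of scalar functions along vector fields -/

section ScalarDerivatives

theorem fderiv_mul_apply {f g : ℝ × ℝ → ℝ} {q : ℝ × ℝ} (hf : DifferentiableAt ℝ f q)
    (hg : DifferentiableAt ℝ g q) (w : ℝ × ℝ) :
    fderiv ℝ (fun x => f x * g x) q w = f q * fderiv ℝ g q w + fderiv ℝ f q w * g q := by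
  rw [fderiv_fun_mul hf hg]
  simp [mul_comm]

theorem fderiv_add_apply {f g : ℝ × ℝ → ℝ} {q : ℝ × ℝ} (hf : DifferentiableAt ℝ f q)
    (hg : DifferentiableAt ℝ g q) (w : ℝ × ℝ) :
    fderiv ℝ (fun x => f x + g x) q w = fderiv ℝ f q w + fderiv ℝ g q w := by
  rw [fderiv_fun_add hf hg]
  rfl

theorem fderiv_snd_apply (q w : ℝ × ℝ) : fderiv ℝ (fun x : ℝ × ℝ => x.2) q w = w.2 := by
  rw [fderiv_snd]
  rfl

theorem fderiv_fst_apply (q w : ℝ × ℝ) : fderiv ℝ (fun x : ℝ × ℝ => x.1) q w = w.1 := by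
  rw [fderiv_fst]
  rfl

theorem fderiv_apply_eq_partials (f : ℝ × ℝ → ℝ) (q w : ℝ × ℝ) :
    fderiv ℝ f q w = w.1 * fderiv ℝ f q (1, 0) + w.2 * fderiv ℝ f q (0, 1) := by
  conv_lhs => rw [show w = w.1 • ((1 : ℝ), (0 : ℝ)) + w.2 • ((0 : ℝ), (1 : ℝ)) by ext <;> simp]
  rw [map_add, map_smul, map_smul, smul_eq_mul, smul_eq_mul]

/-- The second derivative at the origin along a null field of a function with partial derivatives
`β` and `v B`. -/
theorem fderiv_fderiv_null {χ β B : ℝ × ℝ → ℝ} {ζ : ℝ × ℝ → ℝ × ℝ} (hβ : SmoothGerm β 0)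
    (hB : SmoothGerm B 0) (hζ : SmoothGerm ζ 0)
    (hχ : ∀ᶠ q in 𝓝 (0 : ℝ × ℝ), ∀ w, fderiv ℝ χ q w = w.1 * β q + w.2 * (q.2 * B q))
    (h0 : (ζ 0).1 = 0) :
    fderiv ℝ (fun q => fderiv ℝ χ q (ζ q)) 0 (ζ 0) =
      (ζ 0).2 * fderiv ℝ (fun q => (ζ q).1) 0 (0, 1) * β 0 + (ζ 0).2 ^ 2 * B 0 := by
  have h1 : (fun q => fderiv ℝ χ q (ζ q)) =ᶠ[𝓝 0]
      fun q => (ζ q).1 * β q + (ζ q).2 * (q.2 * B q) := hχ.mono fun q hq => hq _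
  have d1 := hζ.fst.differentiableAt
  have d2 := hζ.snd.differentiableAt
  have d3 := hβ.differentiableAt
  have d4 := hB.differentiableAt
  rw [h1.fderiv_eq, fderiv_add_apply (by fun_prop) (by fun_prop), fderiv_mul_apply d1 d3,
    fderiv_mul_apply d2 (by fun_prop), fderiv_mul_apply (by fun_prop) d4, fderiv_snd_apply,
    fderiv_apply_eq_partials (fun q => (ζ q).1) 0 (ζ 0), h0]
  simp
  ring

/-- Meant for the third component of the normal form: direction `(0, 1)` enters `η³f` and direction
`(1, 0)` enters `ξη²f`. The vanishing of `β`, `β_v` and `B` at the origin removes every derivative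
of the field except the `v`-derivative of its first component, which survives against `β_u`. -/
theorem fderiv_fderiv_fderiv_null {χ β B : ℝ × ℝ → ℝ} {ζ : ℝ × ℝ → ℝ × ℝ} (hβ : SmoothGerm β 0)
    (hB : SmoothGerm B 0) (hζ : SmoothGerm ζ 0)
    (hχ : ∀ᶠ q in 𝓝 (0 : ℝ × ℝ), ∀ w, fderiv ℝ χ q w = w.1 * β q + w.2 * (q.2 * B q))
    (h0 : (ζ 0).1 = 0) (hβ0 : β 0 = 0) (hβv : fderiv ℝ β 0 (0, 1) = 0) (hB0 : B 0 = 0) :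
    fderiv ℝ (fun p => fderiv ℝ (fun q => fderiv ℝ χ q (ζ q)) p (ζ p)) 0 (0, 1) =
      2 * (ζ 0).2 ^ 2 * fderiv ℝ B 0 (0, 1) ∧
    fderiv ℝ (fun p => fderiv ℝ (fun q => fderiv ℝ χ q (ζ q)) p (ζ p)) 0 (1, 0) =
      (ζ 0).2 * (fderiv ℝ (fun q => (ζ q).1) 0 (0, 1) * fderiv ℝ β 0 (1, 0)
        + (ζ 0).2 * fderiv ℝ B 0 (1, 0)) := by
  have h1 : (fun q => fderiv ℝ χ q (ζ q)) =ᶠ[𝓝 0]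
      fun q => (ζ q).1 * β q + (ζ q).2 * (q.2 * B q) := hχ.mono fun q hq => hq _
  have hζ1 : SmoothGerm (fun q => (ζ q).1) 0 := hζ.fst
  have hζ2 : SmoothGerm (fun q => (ζ q).2) 0 := hζ.snd
  set p : ℝ × ℝ → ℝ := fun q => (ζ q).1
  set r : ℝ × ℝ → ℝ := fun q => (ζ q).2
  have hp0 : p 0 = 0 := h0
  change _ = 2 * r 0 ^ 2 * _ ∧ _ = r 0 * (_ + r 0 * _)
  set X : ℝ × ℝ → ℝ := fun q => p q * β q + r q * (q.2 * B q) with hX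
  have hXs : SmoothGerm X 0 := by fun_prop
  have hr2 : (fun q => fderiv ℝ X q (0, 1)) =ᶠ[𝓝 0] fun q =>
      (p q * fderiv ℝ β q (0, 1) + fderiv ℝ p q (0, 1) * β q) +
        (r q * (q.2 * fderiv ℝ B q (0, 1) + B q) + fderiv ℝ r q (0, 1) * (q.2 * B q)) := by
    filter_upwards [hζ1.eventually_differentiableAt, hζ2.eventually_differentiableAt,
      hβ.eventually_differentiableAt, hB.eventually_differentiableAt] with q d1 d2 d3 d4
    rw [fderiv_add_apply (by fun_prop) (by fun_prop), fderiv_mul_apply d1 d3,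
      fderiv_mul_apply d2 (by fun_prop), fderiv_mul_apply (by fun_prop) d4, fderiv_snd_apply]
    simp
  have hr1 : fderiv ℝ X 0 (1, 0) = 0 := by
    have d1 := hζ1.differentiableAt
    have d2 := hζ2.differentiableAt
    have d3 := hβ.differentiableAt
    have d4 := hB.differentiableAt
    rw [fderiv_add_apply (by fun_prop) (by fun_prop), fderiv_mul_apply d1 d3,
      fderiv_mul_apply d2 (by fun_prop), fderiv_mul_apply (by fun_prop) d4, fderiv_snd_apply, hp0,
      hβ0]
    simp
  have h2 : (fun q => fderiv ℝ (fun q => fderiv ℝ χ q (ζ q)) q (ζ q)) =ᶠ[𝓝 0]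
      fun q => p q * fderiv ℝ X q (1, 0) + r q * fderiv ℝ X q (0, 1) := by
    filter_upwards [h1.eventuallyEq_nhds] with q hq
    rw [hq.fderiv_eq, fderiv_apply_eq_partials]
  have hXu : SmoothGerm (fun q => fderiv ℝ X q (1, 0)) 0 := by fun_prop
  have hXv : SmoothGerm (fun q => fderiv ℝ X q (0, 1)) 0 := by fun_prop
  have hβv' : SmoothGerm (fun q => fderiv ℝ β q (0, 1)) 0 := by fun_prop
  have hBv' : SmoothGerm (fun q => fderiv ℝ B q (0, 1)) 0 := by fun_prop
  have hpv' : SmoothGerm (fun q => fderiv ℝ p q (0, 1)) 0 := by fun_prop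
  have hrv' : SmoothGerm (fun q => fderiv ℝ r q (0, 1)) 0 := by fun_prop
  have hXv0 : fderiv ℝ X 0 (0, 1) = 0 := by
    rw [hr2.eq_of_nhds, hp0, hβ0, hB0]
    simp
  have key (w : ℝ × ℝ) :
      fderiv ℝ (fun p => fderiv ℝ (fun q => fderiv ℝ χ q (ζ q)) p (ζ p)) 0 w =
        r 0 * (fderiv ℝ p 0 w * fderiv ℝ β 0 (0, 1) + fderiv ℝ p 0 (0, 1) * fderiv ℝ β 0 w +
          r 0 * (w.2 * fderiv ℝ B 0 (0, 1) + fderiv ℝ B 0 w)) := by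
    have d1 := hζ1.differentiableAt
    have d2 := hζ2.differentiableAt
    have d3 := hβ.differentiableAt
    have d4 := hB.differentiableAt
    have d5 := hβv'.differentiableAt
    have d6 := hBv'.differentiableAt
    have d7 := hpv'.differentiableAt
    have d8 := hrv'.differentiableAt
    have d9 := hXu.differentiableAt
    have d10 := hXv.differentiableAt
    rw [h2.fderiv_eq, fderiv_add_apply (d1.fun_mul d9) (d2.fun_mul d10), fderiv_mul_apply d1 d9,
      fderiv_mul_apply d2 d10, hp0, hr1, hXv0, hr2.fderiv_eq,
      fderiv_add_apply ((d1.fun_mul d5).fun_add (d7.fun_mul d3)) (by fun_prop),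
      fderiv_add_apply (d1.fun_mul d5) (d7.fun_mul d3), fderiv_mul_apply d1 d5, fderiv_mul_apply d7 d3,
      fderiv_add_apply (by fun_prop) (by fun_prop), fderiv_mul_apply d2 (by fun_prop),
      fderiv_add_apply (by fun_prop) d4, fderiv_mul_apply (by fun_prop) d6, fderiv_snd_apply,
      fderiv_mul_apply d8 (by fun_prop), fderiv_mul_apply (by fun_prop) d4, fderiv_snd_apply, hp0,
      hβ0, hB0]
    simp
  rw [key, key, hβv]
  constructor
  · ring
  · simp

/-- The second derivative along a field which is tangent to the first axis at the origin. -/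
theorem fderiv_fderiv_tangent {χ β B : ℝ × ℝ → ℝ} {ζ : ℝ × ℝ → ℝ × ℝ} (hβ : SmoothGerm β 0)
    (hB : SmoothGerm B 0) (hζ : SmoothGerm ζ 0)
    (hχ : ∀ᶠ q in 𝓝 (0 : ℝ × ℝ), ∀ w, fderiv ℝ χ q w = w.1 * β q + w.2 * (q.2 * B q))
    (h0 : (ζ 0).2 = 0) (hβ0 : β 0 = 0) :
    fderiv ℝ (fun q => fderiv ℝ χ q (ζ q)) 0 (ζ 0) = (ζ 0).1 ^ 2 * fderiv ℝ β 0 (1, 0) := by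
  have h1 : (fun q => fderiv ℝ χ q (ζ q)) =ᶠ[𝓝 0]
      fun q => (ζ q).1 * β q + (ζ q).2 * (q.2 * B q) := hχ.mono fun q hq => hq _
  have d1 := hζ.fst.differentiableAt
  have d2 := hζ.snd.differentiableAt
  have d3 := hβ.differentiableAt
  have d4 := hB.differentiableAt
  rw [h1.fderiv_eq, fderiv_add_apply (by fun_prop) (by fun_prop), fderiv_mul_apply d1 d3,
    fderiv_mul_apply d2 (by fun_prop), fderiv_mul_apply (by fun_prop) d4, fderiv_snd_apply,
    fderiv_apply_eq_partials β 0 (ζ 0), h0, hβ0]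
  simp
  ring

end ScalarDerivatives

/-! ### Partial derivatives of the normal form -/

section NormalForm

/-- The coefficient `β` of the normal form: the `u`-derivative of its third component. -/
noncomputable def edgeBeta (b₀ : ℝ → ℝ) (b : ℝ × ℝ → ℝ) (q : ℝ × ℝ) : ℝ :=
  q.1 * (b₀ q.1 + q.1 * deriv b₀ q.1 / 2) + q.2 ^ 2 * (fderiv ℝ b q (1, 0) / 2)

/-- The coefficient `B` of the normal form: the `v`-derivative of its third component is `v B`. -/
noncomputable def edgeB (b : ℝ × ℝ → ℝ) (q : ℝ × ℝ) : ℝ := b q + q.2 * (fderiv ℝ b q (0, 1) / 2)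

/-- The coefficient `α` of the normal form: the `u`-derivative of its second component. -/
noncomputable def edgeAlpha (a : ℝ → ℝ) (q : ℝ × ℝ) : ℝ := q.1 * (a q.1 + q.1 * deriv a q.1 / 2)

theorem SmoothGerm.comp_fst {a : ℝ → ℝ} (ha : SmoothGerm a 0) :
    SmoothGerm (fun q : ℝ × ℝ => a q.1) 0 := SmoothGerm.comp (by exact ha) (by fun_prop)

theorem SmoothGerm.edgeAlpha {a : ℝ → ℝ} (ha : SmoothGerm a 0) : SmoothGerm (edgeAlpha a) 0 := by
  have h1 := ha.comp_fst
  have h2 := ha.deriv.comp_fst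
  unfold _root_.edgeAlpha
  fun_prop

theorem SmoothGerm.edgeBeta {b₀ : ℝ → ℝ} {b : ℝ × ℝ → ℝ} (hb₀ : SmoothGerm b₀ 0)
    (hb : SmoothGerm b 0) : SmoothGerm (edgeBeta b₀ b) 0 := by
  have h1 := hb₀.comp_fst
  have h2 := hb₀.deriv.comp_fst
  unfold _root_.edgeBeta
  fun_prop

theorem SmoothGerm.edgeB {b : ℝ × ℝ → ℝ} (hb : SmoothGerm b 0) : SmoothGerm (edgeB b) 0 := by
  unfold _root_.edgeB
  fun_prop

theorem fderiv_edgeNormalForm {a b₀ : ℝ → ℝ} {b : ℝ × ℝ → ℝ} {q : ℝ × ℝ}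
    (ha : DifferentiableAt ℝ a q.1) (hb₀ : DifferentiableAt ℝ b₀ q.1)
    (hb : DifferentiableAt ℝ b q) :
    HasFDerivAt (fun q => edgeNormalForm a b₀ b q 0) (ContinuousLinearMap.fst ℝ ℝ ℝ) q ∧
    (DifferentiableAt ℝ (fun q => edgeNormalForm a b₀ b q 1) q ∧
      ∀ w, fderiv ℝ (fun q => edgeNormalForm a b₀ b q 1) q w
        = w.1 * edgeAlpha a q + w.2 * (q.2 * 1)) ∧
    (DifferentiableAt ℝ (fun q => edgeNormalForm a b₀ b q 2) q ∧
      ∀ w, fderiv ℝ (fun q => edgeNormalForm a b₀ b q 2) q w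
        = w.1 * edgeBeta b₀ b q + w.2 * (q.2 * edgeB b q)) := by
  have hfst : HasFDerivAt (fun q : ℝ × ℝ => q.1) (ContinuousLinearMap.fst ℝ ℝ ℝ) q := hasFDerivAt_fst
  have hsnd : HasFDerivAt (fun q : ℝ × ℝ => q.2) (ContinuousLinearMap.snd ℝ ℝ ℝ) q := hasFDerivAt_snd
  have ha' := ha.hasDerivAt.comp_hasFDerivAt q hfst
  have hb₀' := hb₀.hasDerivAt.comp_hasFDerivAt q hfst
  refine ⟨hfst, ?_, ?_⟩
  · have h := (((hfst.pow 2).mul ha').mul_const (1 / 2)).add ((hsnd.pow 2).mul_const (1 / 2))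
    have h' : HasFDerivAt (fun q => edgeNormalForm a b₀ b q 1) _ q :=
      h.congr_of_eventuallyEq (Eventually.of_forall fun q => by simp [edgeNormalForm]; ring)
    refine ⟨h'.differentiableAt, fun w => ?_⟩
    rw [h'.fderiv]
    simp [edgeAlpha]
    ring
  · have h := (((hfst.pow 2).mul hb₀').mul_const (1 / 2)).add
      (((hsnd.pow 2).mul_const (1 / 2)).mul hb.hasFDerivAt)
    have h' : HasFDerivAt (fun q => edgeNormalForm a b₀ b q 2) _ q :=
      h.congr_of_eventuallyEq (Eventually.of_forall fun q => by simp [edgeNormalForm]; ring)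
    refine ⟨h'.differentiableAt, fun w => ?_⟩
    rw [h'.fderiv]
    simp [edgeBeta, edgeB]
    rw [fderiv_apply_eq_partials b q w]
    ring

variable {a b₀ : ℝ → ℝ} {b : ℝ × ℝ → ℝ}

theorem edgeB_zero (hb0 : b 0 = 0) : edgeB b 0 = 0 := by simp [edgeB, hb0]

theorem edgeBeta_zero : edgeBeta b₀ b 0 = 0 := by simp [edgeBeta]

theorem edgeAlpha_zero : edgeAlpha a 0 = 0 := by simp [edgeAlpha]

theorem fderiv_edgeB (hb : SmoothGerm b 0) :
    fderiv ℝ (edgeB b) 0 (1, 0) = fderiv ℝ b 0 (1, 0) ∧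
      fderiv ℝ (edgeB b) 0 (0, 1) = 3 / 2 * fderiv ℝ b 0 (0, 1) := by
  have hd := hb.differentiableAt
  have hd' : SmoothGerm (fun q => fderiv ℝ b q (0, 1) / 2) 0 := by fun_prop
  have hd'' := hd'.differentiableAt
  have key (w : ℝ × ℝ) : fderiv ℝ (edgeB b) 0 w =
      fderiv ℝ b 0 w + w.2 * (fderiv ℝ b 0 (0, 1) / 2) := by
    unfold edgeB
    rw [fderiv_add_apply hd (DifferentiableAt.fun_mul (by fun_prop) hd''),
      fderiv_mul_apply (by fun_prop) hd'', fderiv_snd_apply]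
    simp
  rw [key, key]
  constructor
  · simp
  · ring

theorem fderiv_edgeBeta (hb₀ : SmoothGerm b₀ 0) (hb : SmoothGerm b 0) :
    fderiv ℝ (edgeBeta b₀ b) 0 (1, 0) = b₀ 0 ∧ fderiv ℝ (edgeBeta b₀ b) 0 (0, 1) = 0 := by
  have h1 := hb₀.comp_fst
  have h2 := hb₀.deriv.comp_fst
  have e1 : SmoothGerm (fun q : ℝ × ℝ => b₀ q.1 + q.1 * deriv b₀ q.1 / 2) 0 := by fun_prop
  have e2 : SmoothGerm (fun q : ℝ × ℝ => q.2 * (fderiv ℝ b q (1, 0) / 2)) 0 := by fun_prop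
  have d1 := e1.differentiableAt
  have d2 := e2.differentiableAt
  have key (w : ℝ × ℝ) : fderiv ℝ (edgeBeta b₀ b) 0 w = w.1 * b₀ 0 := by
    have : edgeBeta b₀ b = fun q => q.1 * (b₀ q.1 + q.1 * deriv b₀ q.1 / 2) +
        q.2 * (q.2 * (fderiv ℝ b q (1, 0) / 2)) := by
      ext q; simp only [edgeBeta]; ring
    rw [this, fderiv_add_apply (DifferentiableAt.fun_mul (by fun_prop) d1)
      (DifferentiableAt.fun_mul (by fun_prop) d2), fderiv_mul_apply (by fun_prop) d1,
      fderiv_mul_apply (by fun_prop) d2, fderiv_snd_apply, fderiv_fst_apply]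
    simp
  rw [key, key]
  simp

end NormalForm

/-! ### Vector fields under coordinate changes -/

/-- The push-forward of a vector field by a diffeomorphism-germ. -/
noncomputable def pushField (Θ Θinv ζ : ℝ × ℝ → ℝ × ℝ) (q : ℝ × ℝ) : ℝ × ℝ :=
  fderiv ℝ Θ (Θinv q) (ζ (Θinv q))

theorem IsDiffeoGerm.tendsto {E F : Type*} [NormedAddCommGroup E] [NormedSpace ℝ E]
    [NormedAddCommGroup F] [NormedSpace ℝ F] {Φ : E → F} {Ψ : F → E} (h : IsDiffeoGerm Φ Ψ) :
    Tendsto Φ (𝓝 0) (𝓝 0) := by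
  have := h.smooth.continuousAt.tendsto
  rwa [h.map_zero] at this

theorem IsDiffeoGerm.symm {E F : Type*} [NormedAddCommGroup E] [NormedSpace ℝ E]
    [NormedAddCommGroup F] [NormedSpace ℝ F] {Φ : E → F} {Ψ : F → E} (h : IsDiffeoGerm Φ Ψ) :
    IsDiffeoGerm Ψ Φ :=
  ⟨h.smooth_inv, h.smooth, h.inv_zero, h.map_zero, h.right_inv, h.left_inv⟩

theorem IsDiffeoGerm.eventually_injective {E F : Type*} [NormedAddCommGroup E] [NormedSpace ℝ E]
    [NormedAddCommGroup F] [NormedSpace ℝ F] {Φ : E → F} {Ψ : F → E} (h : IsDiffeoGerm Φ Ψ) :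
    ∀ᶠ p in 𝓝 0, Function.Injective (fderiv ℝ Φ p) := by
  filter_upwards [(show ∀ᶠ p in 𝓝 0, (fun x => Ψ (Φ x)) =ᶠ[𝓝 p] fun x => x from
      h.left_inv.eventually_nhds), h.smooth.eventually_differentiableAt,
    h.tendsto.eventually h.smooth_inv.eventually_differentiableAt] with p h1 h2 h3
  have e := (h3.hasFDerivAt.comp p h2.hasFDerivAt).unique
    ((hasFDerivAt_id p).congr_of_eventuallyEq h1)
  intro x y hxy
  have ex := congrArg (fun T => T x) e
  have ey := congrArg (fun T => T y) e
  simp only [ContinuousLinearMap.comp_apply, ContinuousLinearMap.id_apply] at ex ey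
  rw [← ex, ← ey, hxy]

theorem SmoothGerm.pushField {Θ Θinv ζ : ℝ × ℝ → ℝ × ℝ} (h : IsDiffeoGerm Θ Θinv)
    (hζ : SmoothGerm ζ 0) : SmoothGerm (pushField Θ Θinv ζ) 0 := by
  have h1 : SmoothGerm (fun p => _root_.fderiv ℝ Θ p (ζ p)) 0 := h.smooth.fderiv_apply hζ
  exact SmoothGerm.comp (g := fun p => _root_.fderiv ℝ Θ p (ζ p)) (by rwa [h.inv_zero])
    h.smooth_inv

theorem SmoothGerm.dirD {ζ : ℝ × ℝ → ℝ × ℝ} {G : ℝ × ℝ → E3} {p : ℝ × ℝ} (hG : SmoothGerm G p)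
    (hζ : SmoothGerm ζ p) : SmoothGerm (dirD ζ G) p := hG.fderiv_apply hζ

/-- The conclusion has the same form as the hypothesis on `F`, so the lemma iterates and transports
all higher derivatives along fields to normal coordinates. -/
theorem dirD_comp {Θ Θinv ζ : ℝ × ℝ → ℝ × ℝ} {F G : ℝ × ℝ → E3} (L : E3 ≃ₗᵢ[ℝ] E3)
    (h : IsDiffeoGerm Θ Θinv) (hG : SmoothGerm G 0) (hF : F =ᶠ[𝓝 0] fun p => L (G (Θ p))) :
    dirD ζ F =ᶠ[𝓝 0] fun p => L (dirD (pushField Θ Θinv ζ) G (Θ p)) := by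
  filter_upwards [hF.eventuallyEq_nhds, h.smooth.eventually_differentiableAt,
    h.tendsto.eventually hG.eventually_differentiableAt, h.left_inv] with p h1 h2 h3 h4
  have e := L.toContinuousLinearEquiv.hasFDerivAt.comp p (h3.hasFDerivAt.comp p h2.hasFDerivAt)
  rw [dirD, (e.congr_of_eventuallyEq h1).fderiv]
  simp [dirD, pushField, h4]

theorem dirD_apply {ζ : ℝ × ℝ → ℝ × ℝ} {G : ℝ × ℝ → E3} {q : ℝ × ℝ}
    (hG : DifferentiableAt ℝ G q) (i : Fin 3) :
    dirD ζ G q i = fderiv ℝ (fun q => G q i) q (ζ q) := by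
  have h := ((EuclideanSpace.proj i : E3 →L[ℝ] ℝ).hasFDerivAt (x := G q)).comp q hG.hasFDerivAt
  have h' : HasFDerivAt (fun q => G q i) _ q := h
  rw [h'.fderiv]
  rfl

theorem dirD_dirD_apply {ζ ζ' : ℝ × ℝ → ℝ × ℝ} {G : ℝ × ℝ → E3}
    (hζ : SmoothGerm ζ 0) (hG : SmoothGerm G 0) (i : Fin 3) :
    dirD ζ' (dirD ζ G) 0 i = fderiv ℝ (fun q => fderiv ℝ (fun q => G q i) q (ζ q)) 0 (ζ' 0) := by
  rw [dirD_apply (hG.dirD hζ).differentiableAt]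
  congr 1
  refine Filter.EventuallyEq.fderiv_eq ?_
  filter_upwards [hG.eventually_differentiableAt] with q hq using dirD_apply hq i

theorem dirD_dirD_dirD_apply {ζ ζ' ζ'' : ℝ × ℝ → ℝ × ℝ} {G : ℝ × ℝ → E3}
    (hζ : SmoothGerm ζ 0) (hζ' : SmoothGerm ζ' 0) (hG : SmoothGerm G 0) (i : Fin 3) :
    dirD ζ'' (dirD ζ' (dirD ζ G)) 0 i =
      fderiv ℝ (fun p => fderiv ℝ (fun q => fderiv ℝ (fun q => G q i) q (ζ q)) p (ζ' p)) 0
        (ζ'' 0) := by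
  rw [dirD_dirD_apply hζ' (hG.dirD hζ)]
  congr 1
  refine Filter.EventuallyEq.fderiv_eq ?_
  have h : (fun q => dirD ζ G q i) =ᶠ[𝓝 0] fun q => fderiv ℝ (fun q => G q i) q (ζ q) := by
    filter_upwards [hG.eventually_differentiableAt] with q hq using dirD_apply hq i
  filter_upwards [h.eventuallyEq_nhds] with q hq
  rw [hq.fderiv_eq]

theorem det_prod_eq (M : ℝ × ℝ →L[ℝ] ℝ × ℝ) :
    M.det = (M (1, 0)).1 * (M (0, 1)).2 - (M (0, 1)).1 * (M (1, 0)).2 := by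
  rw [ContinuousLinearMap.det, ← LinearMap.det_toMatrix (Module.Basis.finTwoProd ℝ),
    Matrix.det_fin_two]
  simp [LinearMap.toMatrix_apply]

theorem det_mul_area (M : ℝ × ℝ →L[ℝ] ℝ × ℝ) (x y : ℝ × ℝ) :
    M.det * (x.1 * y.2 - x.2 * y.1) = (M x).1 * (M y).2 - (M x).2 * (M y).1 := by
  have h (w : ℝ × ℝ) : M w = w.1 • M (1, 0) + w.2 • M (0, 1) := by
    conv_lhs => rw [show w = w.1 • ((1 : ℝ), (0 : ℝ)) + w.2 • ((0 : ℝ), (1 : ℝ)) by ext <;> simp]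
    rw [map_add, map_smul, map_smul]
  rw [det_prod_eq, h x, h y]
  simp
  ring

/-! ### Cuspidal torsion and cuspidal curvature in normal coordinates -/

namespace EdgeNormalized

variable {f : ℝ × ℝ → E3} {L : E3 ≃ₗᵢ[ℝ] E3} {Θ Θinv : ℝ × ℝ → ℝ × ℝ} {a b₀ : ℝ → ℝ}
  {b : ℝ × ℝ → ℝ}

theorem smooth_normalForm (h : EdgeNormalized f L Θ Θinv a b₀ b) :
    SmoothGerm (edgeNormalForm a b₀ b) 0 :=
  .edgeNormalForm h.smooth_a h.smooth_b₀ h.smooth_b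

theorem eventually_fderiv_normalForm (h : EdgeNormalized f L Θ Θinv a b₀ b) :
    ∀ᶠ q in 𝓝 (0 : ℝ × ℝ), ∀ w,
      fderiv ℝ (fun q => edgeNormalForm a b₀ b q 0) q w = w.1 ∧
      fderiv ℝ (fun q => edgeNormalForm a b₀ b q 1) q w
        = w.1 * edgeAlpha a q + w.2 * (q.2 * 1) ∧
      fderiv ℝ (fun q => edgeNormalForm a b₀ b q 2) q w
        = w.1 * edgeBeta b₀ b q + w.2 * (q.2 * edgeB b q) := by
  have ht : Tendsto (Prod.fst : ℝ × ℝ → ℝ) (𝓝 0) (𝓝 0) := continuous_fst.tendsto 0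
  filter_upwards [ht.eventually h.smooth_a.eventually_differentiableAt,
    ht.eventually h.smooth_b₀.eventually_differentiableAt,
    h.smooth_b.eventually_differentiableAt] with q h1 h2 h3 w
  obtain ⟨e1, e2, e3⟩ := fderiv_edgeNormalForm h1 h2 h3
  exact ⟨by rw [e1.fderiv]; rfl, e2.2 w, e3.2 w⟩

/-- The first two components of the differential send `w` to `w.1` and `w.1 α + w.2 v`, which
already determine `w` when `v ≠ 0`. This inclusion suffices to make the tangent of the singular set
horizontal. -/
theorem eventually_singular (h : EdgeNormalized f L Θ Θinv a b₀ b) :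
    ∀ᶠ p in 𝓝 (0 : ℝ × ℝ), p ∈ singularSet f → (Θ p).2 = 0 := by
  filter_upwards [h.diffeo.eventually_injective, h.eq_comp.eventuallyEq_nhds,
    h.diffeo.smooth.eventually_differentiableAt,
    h.diffeo.tendsto.eventually h.smooth_normalForm.eventually_differentiableAt,
    h.diffeo.tendsto.eventually h.eventually_fderiv_normalForm] with p h1 h2 h3 h4 h5 hp
  by_contra hv
  refine hp ?_
  rw [((L.toContinuousLinearEquiv.hasFDerivAt.comp p
    (h4.hasFDerivAt.comp p h3.hasFDerivAt)).congr_of_eventuallyEq h2).fderiv]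
  refine L.injective.comp (Function.Injective.comp
    (g := fderiv ℝ (edgeNormalForm a b₀ b) (Θ p)) (f := fderiv ℝ Θ p) ?_ h1)
  refine (injective_iff_map_eq_zero _).2 fun w hw => ?_
  have hi (i : Fin 3) : fderiv ℝ (fun q => edgeNormalForm a b₀ b q i) (Θ p) w = 0 := by
    rw [← dirD_apply (ζ := fun _ => w) h4 i, dirD, hw]
    rfl
  have e1 := hi 0
  have e2 := hi 1
  rw [(h5 w).1] at e1
  rw [(h5 w).2.1, e1] at e2
  have e3 : w.2 = 0 := by simpa [hv] using e2
  exact Prod.ext e1 e3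

/-- The cuspidal torsion and the cuspidal curvature at the origin in terms of the normal form. -/
theorem cuspidal_invariants (h : EdgeNormalized f L Θ Θinv a b₀ b) {μ : ℝ → ℝ × ℝ}
    {ξ η : ℝ × ℝ → ℝ × ℝ} (hp : IsAdaptedPair 2 f μ ξ η) :
    cuspidalTorsion 2 f ξ η μ 0 = fderiv ℝ b 0 (1, 0) ∧
      cuspidalCurvature 2 f ξ η μ 0 = 3 * fderiv ℝ b 0 (0, 1) := by
  have hg := h.smooth_normalForm
  set g := edgeNormalForm a b₀ b with hgdef
  set ξ' := pushField Θ Θinv ξ with hξ'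
  set η' := pushField Θ Θinv η with hη'
  have hξs : SmoothGerm ξ' 0 := .pushField h.diffeo hp.smooth_tangent
  have hηs : SmoothGerm η' 0 := .pushField h.diffeo hp.smooth_null
  have hξ0 : ξ' 0 = fderiv ℝ Θ 0 (ξ 0) := by simp [hξ', pushField, h.diffeo.inv_zero]
  have hη0 : η' 0 = fderiv ℝ Θ 0 (η 0) := by simp [hη', pushField, h.diffeo.inv_zero]
  have hμ0 := hp.param.map_zero
  have hforms := h.eventually_fderiv_normalForm
  have hform0 := hforms.self_of_nhds
  -- derivatives in normal coordinates
  have d1 := dirD_comp (ζ := ξ) L h.diffeo hg h.eq_comp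
  have n1 := dirD_comp (ζ := η) L h.diffeo hg h.eq_comp
  have n2 := dirD_comp (ζ := η) L h.diffeo (hg.dirD hηs) n1
  have n3 := dirD_comp (ζ := η) L h.diffeo ((hg.dirD hηs).dirD hηs) n2
  have m2 := dirD_comp (ζ := ξ) L h.diffeo ((hg.dirD hηs).dirD hηs) n2
  have d2 := dirD_comp (ζ := ξ) L h.diffeo (hg.dirD hξs) d1
  have D1 := d1.eq_of_nhds
  have N1 := n1.eq_of_nhds
  have N2 := n2.eq_of_nhds
  have N3 := n3.eq_of_nhds
  have M2 := m2.eq_of_nhds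
  have D2 := d2.eq_of_nhds
  simp only [h.diffeo.map_zero] at D1 N1 N2 N3 M2 D2
  -- the fields at the origin
  have hη1 : (η' 0).1 = 0 := by
    have e := (hp.null.self_of_nhds (η 0)).2 ⟨1, by rw [hμ0, one_smul]⟩
    rw [hμ0] at e
    change dirD η f 0 = 0 at e
    rw [N1, LinearIsometryEquiv.map_eq_zero_iff] at e
    have e' := congrArg (fun x : E3 => x 0) e
    simp only at e'
    rw [dirD_apply hg.differentiableAt, (hform0 _).1] at e'
    exact e'
  have hξ2 : (ξ' 0).2 = 0 := by
    obtain ⟨c, -, hc⟩ := hp.tangent.self_of_nhds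
    rw [hμ0] at hc
    have hμt : Tendsto μ (𝓝 0) (𝓝 0) := by
      have := hp.param.smooth.continuousAt.tendsto
      rwa [hμ0] at this
    have hz : (fun t => (Θ (μ t)).2) =ᶠ[𝓝 0] fun _ => 0 := by
      filter_upwards [hμt.eventually h.eventually_singular, hp.param.mem] with t e1 e2 using e1 e2
    have hΘ : HasFDerivAt Θ (fderiv ℝ Θ 0) (μ 0) := by
      rw [hμ0]; exact h.diffeo.smooth.differentiableAt.hasFDerivAt
    have e := (hasFDerivAt_snd (p := Θ (μ 0))).comp_hasDerivAt (0 : ℝ)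
      (hΘ.comp_hasDerivAt (0 : ℝ) hp.param.smooth.hasDerivAt)
    have e' := e.unique ((hasDerivAt_const (0 : ℝ) (0 : ℝ)).congr_of_eventuallyEq hz)
    rw [hξ0, hc, map_smul]
    simp only [Prod.smul_snd]
    rw [show (fderiv ℝ Θ 0 (deriv μ 0)).2 = 0 from e', smul_zero]
  have hpos : 0 < (ξ' 0).1 * (η' 0).2 := by
    have e := hp.positive.self_of_nhds
    rw [hμ0] at e
    have := mul_pos h.positive e
    rw [det_mul_area, ← hξ0, ← hη0, hξ2] at this
    simpa using this
  set c := (ξ' 0).1 with hc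
  set r := (η' 0).2 with hr
  set P := fderiv ℝ (fun q => (η' q).1) 0 (0, 1) with hP
  have hα := h.smooth_a.edgeAlpha
  have hβ := SmoothGerm.edgeBeta h.smooth_b₀ h.smooth_b
  have hB := h.smooth_b.edgeB
  obtain ⟨B1, B2⟩ := fderiv_edgeB h.smooth_b
  obtain ⟨β1, β2⟩ := fderiv_edgeBeta (b := b) h.smooth_b₀ h.smooth_b
  have hf3 := hforms.mono fun q hq w => (hq w).2.2
  have hf2 := hforms.mono fun q hq w => (hq w).2.1
  -- The first component fits the pattern of the scalar lemmas with `β = 1` and `B = 0`.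
  have hf1 : ∀ᶠ q in 𝓝 (0 : ℝ × ℝ), ∀ w, fderiv ℝ (fun q => g q 0) q w =
      w.1 * 1 + w.2 * (q.2 * 0) := hforms.mono fun q hq w => by rw [(hq w).1]; ring
  have V1 : dirD ξ' g 0 = !₂[c, 0, 0] := by
    ext i
    rw [dirD_apply hg.differentiableAt]
    fin_cases i
    · exact (hform0 _).1
    · refine (hform0 _).2.1.trans ?_
      simp [edgeAlpha_zero]
    · refine (hform0 _).2.2.trans ?_
      simp [edgeBeta_zero]
  have V2 : dirD η' (dirD η' g) 0 = !₂[r * P, r ^ 2, 0] := by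
    ext i
    rw [dirD_dirD_apply hηs hg]
    fin_cases i
    · refine (fderiv_fderiv_null (.const 1) (.const 0) hηs hf1 hη1).trans ?_
      simp [hr, hP]
    · refine (fderiv_fderiv_null hα (.const 1) hηs hf2 hη1).trans ?_
      simp [hr, edgeAlpha_zero]
    · refine (fderiv_fderiv_null hβ hB hηs hf3 hη1).trans ?_
      simp [edgeBeta_zero, edgeB_zero h.b_zero]
  obtain ⟨T1, T2⟩ := fderiv_fderiv_fderiv_null hβ hB hηs hf3 hη1 edgeBeta_zero β2
    (edgeB_zero h.b_zero)
  have V3 : dirD η' (dirD η' (dirD η' g)) 0 2 = r ^ 3 * (3 * fderiv ℝ b 0 (0, 1)) := by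
    rw [dirD_dirD_dirD_apply hηs hηs hg, fderiv_apply_eq_partials, hη1, T1, B2]
    ring
  have W : dirD ξ' (dirD η' (dirD η' g)) 0 2 =
      c * (r * (P * b₀ 0 + r * fderiv ℝ b 0 (1, 0))) := by
    rw [dirD_dirD_dirD_apply hηs hηs hg, fderiv_apply_eq_partials, hξ2, T2, B1, β1]
    ring
  have Z : dirD ξ' (dirD ξ' g) 0 2 = c ^ 2 * b₀ 0 := by
    rw [dirD_dirD_apply hξs hg, fderiv_fderiv_tangent hβ hB hξs hf3 hξ2 edgeBeta_zero, β1]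
  have hnorm : ‖(!₂[c, 0, 0] : E3)‖ = |c| := by
    rw [EuclideanSpace.norm_eq, Fin.sum_univ_three]
    simp [Real.sqrt_sq_eq_abs]
  have hcross : ‖cross3 (!₂[c, 0, 0] : E3) (!₂[r * P, r ^ 2, 0] : E3)‖ = |c| * r ^ 2 := by
    rw [norm_cross3, inner_eq_sum_three, inner_eq_sum_three, inner_eq_sum_three]
    have : |c| * r ^ 2 = √((c * r ^ 2) ^ 2) := by
      rw [Real.sqrt_sq_eq_abs, abs_mul, abs_of_nonneg (sq_nonneg r)]
    rw [this]
    congr 1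
    simp
    ring
  have hc0 : c ≠ 0 := fun e => by simp [e] at hpos
  have hr0 : r ≠ 0 := fun e => by simp [e] at hpos
  have hinner : inner ℝ (!₂[c, 0, 0] : E3) (!₂[r * P, r ^ 2, 0] : E3) = c * (r * P) := by
    rw [inner_eq_sum_three]; simp
  have hdet (z : E3) : det3 (!₂[c, 0, 0]) (!₂[r * P, r ^ 2, 0]) z = c * r ^ 2 * z 2 := by
    rw [det3_eq]; simp; ring
  constructor
  · simp only [cuspidalTorsion, Function.iterate_succ, Function.iterate_zero, Function.comp_apply,
      id_eq, hμ0]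
    rw [D1, N2, M2, D2, h.det3_map, h.det3_map, norm_cross3_linearIsometry, L.inner_map_map,
      L.norm_map, V1, V2, hcross, hdet, hdet, W, Z, hinner, hnorm]
    have : |c| ^ 2 = c ^ 2 := sq_abs c
    rw [mul_pow, this]
    -- The first quotient is `b_u + P b₀ / r` and the second is `P b₀ / r`: the correction term of
    -- the torsion removes the dependence on the extension of the null field.
    field_simp
    ring
  · simp only [cuspidalCurvature, Function.iterate_succ, Function.iterate_zero,
      Function.comp_apply, id_eq, hμ0]
    rw [D1, N2, N3, h.det3_map, norm_cross3_linearIsometry, L.norm_map, V1, V2, hcross, hdet, V3,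
      hnorm]
    have hca : 0 < |c| := abs_pos.2 hc0
    -- The exponent `5/2` splits as `3/2 + 1`, to cancel the factor `|c| ^ (3/2)`; positivity of the
    -- pair, `c r > 0`, then settles the sign of `c r⁵`.
    have e1 : (|c| * r ^ 2) ^ ((2 * ((2 : ℕ) : ℝ) + 1) / ((2 : ℕ) : ℝ)) =
        |c| ^ ((((2 : ℕ) : ℝ) + 1) / ((2 : ℕ) : ℝ)) * |c| * |r| ^ 5 := by
      rw [Real.mul_rpow hca.le (sq_nonneg r), ← Real.rpow_add_one hca.ne', ← sq_abs r,
        ← Real.rpow_natCast |r| 2, ← Real.rpow_mul (abs_nonneg r), ← Real.rpow_natCast |r| 5]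
      norm_num
    have e2 : |c| * |r| ^ 5 = c * r ^ 5 := by
      have e3 : |c| * |r| = c * r := by rw [← abs_mul, abs_of_pos hpos]
      have e4 : |r| ^ 4 = r ^ 4 := by
        rw [← abs_pow]; exact abs_of_nonneg (by positivity)
      calc |c| * |r| ^ 5 = (|c| * |r|) * |r| ^ 4 := by ring
        _ = c * r ^ 5 := by rw [e3, e4]; ring
    rw [e1, mul_assoc (|c| ^ _) |c|, e2]
    have e5 : |c| ^ ((((2 : ℕ) : ℝ) + 1) / ((2 : ℕ) : ℝ)) ≠ 0 := (Real.rpow_pos_of_pos hca _).ne'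
    rw [mul_div_mul_left _ _ e5]
    field_simp

end EdgeNormalized

theorem deriv_eventuallyEq_of_eq_pow_mul {f z : ℝ → ℝ} {n : ℕ} (hz : SmoothGerm z 0)
    (h : f =ᶠ[𝓝 0] fun t => t ^ (n + 1) * z t) :
    deriv f =ᶠ[𝓝 0] fun t => t ^ n * ((n + 1) * z t + t * deriv z t) := by
  filter_upwards [h.eventuallyEq_nhds, hz.eventually_hasDerivAt] with t ht hd
  rw [ht.deriv_eq, ((hasDerivAt_pow (n + 1) t).fun_mul hd).deriv]
  push_cast
  ring

/-! ### Leading terms of the three numerators -/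

section CurveCoefficients

/-- The determinant of the reduced velocity, its derivative and the normal vector. -/
noncomputable def reducedGeodesic (y α β B : ℝ → ℝ) (t : ℝ) : ℝ :=
  -deriv y t * ((α t * B t - β t) ^ 2 + B t ^ 2 + 1)
    + y t * (y t * deriv α t + (y t * deriv β t + deriv B t) * B t)
    + (1 + y t * α t) * (y t * deriv β t + deriv B t) * (α t * B t - β t)
    - (y t * β t + B t) * (y t * deriv α t) * (α t * B t - β t)

/-- The inner product of the derivative of the reduced velocity with the normal vector. -/
noncomputable def reducedNormal (y α β B : ℝ → ℝ) (t : ℝ) : ℝ :=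
  deriv y t * (α t * B t - β t) - (deriv y t * α t + y t * deriv α t) * B t
    + (deriv y t * β t + y t * deriv β t + deriv B t)

/-- The determinant of the reduced velocity, the normal vector and its derivative. -/
noncomputable def reducedTorsion (y α β B : ℝ → ℝ) (t : ℝ) : ℝ :=
  y t * deriv B t + (1 + y t * α t) * (deriv α t * B t + α t * deriv B t - deriv β t)
    + (y t * β t + B t) * (B t * (deriv α t * B t + α t * deriv B t - deriv β t)
      - (α t * B t - β t) * deriv B t)

variable {y α β B α₂ β₂ B₁ : ℝ → ℝ}

theorem SmoothGerm.reducedGeodesic (hy : SmoothGerm y 0) (hα : SmoothGerm α 0)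
    (hβ : SmoothGerm β 0) (hB : SmoothGerm B 0) : SmoothGerm (reducedGeodesic y α β B) 0 := by
  have h1 := hy.deriv
  have h2 := hα.deriv
  have h3 := hβ.deriv
  have h4 := hB.deriv
  unfold _root_.reducedGeodesic
  fun_prop

theorem SmoothGerm.reducedNormal (hy : SmoothGerm y 0) (hα : SmoothGerm α 0)
    (hβ : SmoothGerm β 0) (hB : SmoothGerm B 0) : SmoothGerm (reducedNormal y α β B) 0 := by
  have h1 := hy.deriv
  have h2 := hα.deriv
  have h3 := hβ.deriv
  have h4 := hB.deriv
  unfold _root_.reducedNormal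
  fun_prop

theorem SmoothGerm.reducedTorsion (hy : SmoothGerm y 0) (hα : SmoothGerm α 0)
    (hβ : SmoothGerm β 0) (hB : SmoothGerm B 0) : SmoothGerm (reducedTorsion y α β B) 0 := by
  have h1 := hy.deriv
  have h2 := hα.deriv
  have h3 := hβ.deriv
  have h4 := hB.deriv
  unfold _root_.reducedTorsion
  fun_prop

/-- At `0` the functions `α`, `β`, `B`, `α'` and `β'` all vanish, so only `y`, `y'` and `B' = B₁`
can contribute; the factor `|N|²` multiplying `-y'` becomes `1`. -/
theorem reduced_zero (hα₂ : SmoothGerm α₂ 0) (hβ₂ : SmoothGerm β₂ 0) (hB₁ : SmoothGerm B₁ 0)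
    (hα : α =ᶠ[𝓝 0] fun t => t ^ 2 * α₂ t) (hβ : β =ᶠ[𝓝 0] fun t => t ^ 2 * β₂ t)
    (hB : B =ᶠ[𝓝 0] fun t => t ^ 1 * B₁ t) :
    reducedGeodesic y α β B 0 = -deriv y 0 ∧ reducedNormal y α β B 0 = B₁ 0 ∧
      reducedTorsion y α β B 0 = y 0 * B₁ 0 := by
  have e1 := hα.eq_of_nhds
  have e2 := hβ.eq_of_nhds
  have e3 := hB.eq_of_nhds
  have e4 := (deriv_eventuallyEq_of_eq_pow_mul (n := 1) hα₂ hα).eq_of_nhds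
  have e5 := (deriv_eventuallyEq_of_eq_pow_mul (n := 1) hβ₂ hβ).eq_of_nhds
  have e6 := (deriv_eventuallyEq_of_eq_pow_mul (n := 0) hB₁ hB).eq_of_nhds
  simp at e1 e2 e3 e4 e5 e6
  simp [reducedGeodesic, reducedNormal, reducedTorsion, e1, e2, e3, e4, e5, e6]

theorem reducedGeodesic_eq_mul {Y : ℝ → ℝ} (hα₂ : SmoothGerm α₂ 0) (hβ₂ : SmoothGerm β₂ 0)
    (hB₁ : SmoothGerm B₁ 0) (hY : SmoothGerm Y 0)
    (hα : α =ᶠ[𝓝 0] fun t => t ^ 2 * α₂ t) (hβ : β =ᶠ[𝓝 0] fun t => t ^ 2 * β₂ t)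
    (hB : B =ᶠ[𝓝 0] fun t => t ^ 1 * B₁ t) (hy : y =ᶠ[𝓝 0] fun t => t ^ 2 * Y t) :
    ∃ z, SmoothGerm z 0 ∧ reducedGeodesic y α β B =ᶠ[𝓝 0] (fun t => t ^ 1 * z t) ∧
      z 0 = -2 * Y 0 := by
  have e4 := deriv_eventuallyEq_of_eq_pow_mul (n := 1) hα₂ hα
  have e5 := deriv_eventuallyEq_of_eq_pow_mul (n := 1) hβ₂ hβ
  have e6 := deriv_eventuallyEq_of_eq_pow_mul (n := 0) hB₁ hB
  have e7 := deriv_eventuallyEq_of_eq_pow_mul (n := 1) hY hy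
  have s1 := hα₂.deriv
  have s2 := hβ₂.deriv
  have s3 := hB₁.deriv
  have s4 := hY.deriv
  refine ⟨fun t => -(2 * Y t + t * deriv Y t)
      * ((t ^ 3 * α₂ t * B₁ t - t ^ 2 * β₂ t) ^ 2 + (t * B₁ t) ^ 2 + 1)
    + t * Y t * (t ^ 3 * Y t * (2 * α₂ t + t * deriv α₂ t)
      + (t ^ 3 * Y t * (2 * β₂ t + t * deriv β₂ t) + (B₁ t + t * deriv B₁ t)) * (t * B₁ t))
    + (1 + t ^ 4 * Y t * α₂ t) * (t ^ 3 * Y t * (2 * β₂ t + t * deriv β₂ t)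
      + (B₁ t + t * deriv B₁ t)) * (t ^ 2 * α₂ t * B₁ t - t * β₂ t)
    - (t ^ 4 * Y t * β₂ t + t * B₁ t) * (t ^ 3 * Y t * (2 * α₂ t + t * deriv α₂ t))
      * (t ^ 2 * α₂ t * B₁ t - t * β₂ t), by fun_prop, ?_, by simp⟩
  filter_upwards [hα, hβ, hB, hy, e4, e5, e6, e7] with t h1 h2 h3 h4 h5 h6 h7 h8
  rw [reducedGeodesic, h1, h2, h3, h4, h5, h6, h7, h8]
  push_cast
  ring

/-- Once `y` vanishes to order three, `-y'` is no longer dominant: it and `-B'β` are both of order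
at least two, and every other term is of higher order. This competition separates `l = 5` from `l >
5`. -/
theorem reducedGeodesic_eq_sq_mul {Y : ℝ → ℝ} (hα₂ : SmoothGerm α₂ 0) (hβ₂ : SmoothGerm β₂ 0)
    (hB₁ : SmoothGerm B₁ 0) (hY : SmoothGerm Y 0)
    (hα : α =ᶠ[𝓝 0] fun t => t ^ 2 * α₂ t) (hβ : β =ᶠ[𝓝 0] fun t => t ^ 2 * β₂ t)
    (hB : B =ᶠ[𝓝 0] fun t => t ^ 1 * B₁ t) (hy : y =ᶠ[𝓝 0] fun t => t ^ 3 * Y t) :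
    ∃ z, SmoothGerm z 0 ∧ reducedGeodesic y α β B =ᶠ[𝓝 0] (fun t => t ^ 2 * z t) ∧
      z 0 = -3 * Y 0 - B₁ 0 * β₂ 0 := by
  have e4 := deriv_eventuallyEq_of_eq_pow_mul (n := 1) hα₂ hα
  have e5 := deriv_eventuallyEq_of_eq_pow_mul (n := 1) hβ₂ hβ
  have e6 := deriv_eventuallyEq_of_eq_pow_mul (n := 0) hB₁ hB
  have e7 := deriv_eventuallyEq_of_eq_pow_mul (n := 2) hY hy
  have s1 := hα₂.deriv
  have s2 := hβ₂.deriv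
  have s3 := hB₁.deriv
  have s4 := hY.deriv
  refine ⟨fun t => -(3 * Y t + t * deriv Y t)
      * ((t ^ 3 * α₂ t * B₁ t - t ^ 2 * β₂ t) ^ 2 + (t * B₁ t) ^ 2 + 1)
    + t * Y t * (t ^ 4 * Y t * (2 * α₂ t + t * deriv α₂ t)
      + (t ^ 4 * Y t * (2 * β₂ t + t * deriv β₂ t) + (B₁ t + t * deriv B₁ t)) * (t * B₁ t))
    + (1 + t ^ 5 * Y t * α₂ t) * (t ^ 4 * Y t * (2 * β₂ t + t * deriv β₂ t)
      + (B₁ t + t * deriv B₁ t)) * (t * α₂ t * B₁ t - β₂ t)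
    - (t ^ 5 * Y t * β₂ t + t * B₁ t) * (t ^ 4 * Y t * (2 * α₂ t + t * deriv α₂ t))
      * (t * α₂ t * B₁ t - β₂ t), by fun_prop, ?_, by simp; ring⟩
  filter_upwards [hα, hβ, hB, hy, e4, e5, e6, e7] with t h1 h2 h3 h4 h5 h6 h7 h8
  rw [reducedGeodesic, h1, h2, h3, h4, h5, h6, h7, h8]
  push_cast
  ring

/-- When `y` vanishes at `0`, the terms `y B'` and `-β'` compete at first order. -/
theorem reducedTorsion_eq_mul {Y : ℝ → ℝ} (hα₂ : SmoothGerm α₂ 0) (hβ₂ : SmoothGerm β₂ 0)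
    (hB₁ : SmoothGerm B₁ 0) (hY : SmoothGerm Y 0)
    (hα : α =ᶠ[𝓝 0] fun t => t ^ 2 * α₂ t) (hβ : β =ᶠ[𝓝 0] fun t => t ^ 2 * β₂ t)
    (hB : B =ᶠ[𝓝 0] fun t => t ^ 1 * B₁ t) (hy : y =ᶠ[𝓝 0] fun t => t ^ 1 * Y t) :
    ∃ z, SmoothGerm z 0 ∧ reducedTorsion y α β B =ᶠ[𝓝 0] (fun t => t ^ 1 * z t) ∧
      z 0 = Y 0 * B₁ 0 - 2 * β₂ 0 := by
  have e4 := deriv_eventuallyEq_of_eq_pow_mul (n := 1) hα₂ hα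
  have e5 := deriv_eventuallyEq_of_eq_pow_mul (n := 1) hβ₂ hβ
  have e6 := deriv_eventuallyEq_of_eq_pow_mul (n := 0) hB₁ hB
  have s1 := hα₂.deriv
  have s2 := hβ₂.deriv
  have s3 := hB₁.deriv
  refine ⟨fun t => Y t * (B₁ t + t * deriv B₁ t)
    + (1 + t ^ 3 * Y t * α₂ t) * (t * (2 * α₂ t + t * deriv α₂ t) * B₁ t
      + t * α₂ t * (B₁ t + t * deriv B₁ t) - (2 * β₂ t + t * deriv β₂ t))
    + (t ^ 2 * Y t * β₂ t + B₁ t) * (t * B₁ t * (t ^ 2 * (2 * α₂ t + t * deriv α₂ t) * B₁ t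
      + t ^ 2 * α₂ t * (B₁ t + t * deriv B₁ t) - t * (2 * β₂ t + t * deriv β₂ t))
      - (t ^ 3 * α₂ t * B₁ t - t ^ 2 * β₂ t) * (B₁ t + t * deriv B₁ t)), by fun_prop, ?_,
    by simp; ring⟩
  filter_upwards [hα, hβ, hB, hy, e4, e5, e6] with t h1 h2 h3 h4 h5 h6 h7
  rw [reducedTorsion, h1, h2, h3, h4, h5, h6, h7]
  push_cast
  ring

end CurveCoefficients

/-! ### Taylor coefficients of the curvature of the plane curve -/

section PlanarCurvature

variable {c : ℝ → ℝ × ℝ} {x : ℝ → ℝ}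

theorem planarCurvature_eventuallyEq (hc : ∀ᶠ t in 𝓝 0, c t = (x t, t)) :
    planarCurvature c =ᶠ[𝓝 0]
      fun t => -deriv (deriv x) t / (deriv x t ^ 2 + 1) ^ (3 / 2 : ℝ) := by
  have h1 : (fun t => (c t).1) =ᶠ[𝓝 0] x := hc.mono fun t ht => by simp only [ht]
  have h2 : (fun t => (c t).2) =ᶠ[𝓝 0] fun t => t := hc.mono fun t ht => by simp only [ht]
  filter_upwards [h1.eventuallyEq_nhds, h2.eventuallyEq_nhds] with t e1 e2
  have e3 : deriv (fun t => (c t).2) =ᶠ[𝓝 t] fun _ => 1 :=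
    e2.deriv.trans (Eventually.of_forall fun s => by simp)
  simp only [planarCurvature, iteratedDeriv_succ, iteratedDeriv_zero]
  rw [e1.deriv_eq, e1.deriv.deriv_eq, e3.deriv_eq, e3.eq_of_nhds]
  simp

theorem iteratedDeriv_one_planarCurvature {X : ℝ → ℝ} (hc : ∀ᶠ t in 𝓝 0, c t = (x t, t))
    (hX : SmoothGerm X 0) (hx : x =ᶠ[𝓝 0] fun t => t ^ 2 * X t) :
    iteratedDeriv 1 (planarCurvature c) 0 = -6 * deriv X 0 := by
  have s1 := hX.deriv
  have s2 := s1.deriv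
  have h1 := deriv_eventuallyEq_of_eq_pow_mul (n := 1) hX hx
  have h2 := deriv_eventuallyEq_of_eq_pow_mul (n := 0)
    (z := fun t => ((1 : ℕ) + 1) * X t + t * deriv X t) (by fun_prop) h1
  -- The numerator is `-x''` with `x = t² X`. The denominator is `1 + O(t²)` before taking the
  -- power, so it does not affect the first derivative.
  have hpc : planarCurvature c =ᶠ[𝓝 0] fun t =>
      -(2 * X t + 4 * (t * deriv X t) + t ^ 2 * deriv (deriv X) t)
        * (t ^ 2 * (2 * X t + t * deriv X t) ^ 2 + 1) ^ (-(3 / 2) : ℝ) := by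
    filter_upwards [planarCurvature_eventuallyEq hc, h1, h2, hX.eventually_hasDerivAt,
      s1.eventually_hasDerivAt] with t e1 e2 e3 d1 d2
    have e4 := (d1.const_mul (((1 : ℕ) : ℝ) + 1)).add ((hasDerivAt_id t).mul d2)
    have e4' : deriv (fun t => (((1 : ℕ) : ℝ) + 1) * X t + t * deriv X t) t = _ := e4.deriv
    rw [e1, e2, e3, e4', Real.rpow_neg (by positivity), div_eq_mul_inv]
    congr 1
    · push_cast
      simp
      ring
    · congr 2
      push_cast
      ring
  rw [iteratedDeriv_one, hpc.deriv_eq]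
  have d1 := hX.hasDerivAt
  have d2 := s1.hasDerivAt
  have d3 := s2.hasDerivAt
  have d0 := hasDerivAt_id (0 : ℝ)
  have k1 := (((d1.const_mul 2).add ((d0.mul d2).const_mul 4)).add ((d0.pow 2).mul d3)).neg
  have k2 := (((d0.pow 2).mul (((d1.const_mul 2).add (d0.mul d2)).pow 2)).add_const 1).rpow_const
    (p := (-(3 / 2) : ℝ)) (Or.inl (by simp))
  have k3 := k1.mul k2
  refine Eq.trans (HasDerivAt.deriv (f := fun t =>
      -(2 * X t + 4 * (t * deriv X t) + t ^ 2 * deriv (deriv X) t)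
        * (t ^ 2 * (2 * X t + t * deriv X t) ^ 2 + 1) ^ (-(3 / 2) : ℝ)) k3) ?_
  simp
  ring

theorem iteratedDeriv_three_planarCurvature {Z : ℝ → ℝ} (hc : ∀ᶠ t in 𝓝 0, c t = (x t, t))
    (hZ : SmoothGerm Z 0) (hx : x =ᶠ[𝓝 0] fun t => t ^ 5 * Z t) :
    iteratedDeriv 3 (planarCurvature c) 0 = -120 * Z 0 := by
  have s1 := hZ.deriv
  have h1 := deriv_eventuallyEq_of_eq_pow_mul (n := 4) hZ hx
  have hz1 : SmoothGerm (fun t => ((4 : ℕ) + 1) * Z t + t * deriv Z t) 0 := by fun_prop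
  have h2 := deriv_eventuallyEq_of_eq_pow_mul (n := 3) hz1 h1
  set z₁ : ℝ → ℝ := fun t => ((4 : ℕ) + 1) * Z t + t * deriv Z t with hz₁
  have s2 := hz1.deriv
  have hE : SmoothGerm (fun t => ((t ^ 4 * z₁ t) ^ 2 + 1) ^ (3 / 2 : ℝ)) 0 :=
    SmoothGerm.rpow_const (by fun_prop) (by simp) _
  have hz : SmoothGerm (fun t => -(((3 : ℕ) + 1) * z₁ t + t * deriv z₁ t)
      / ((t ^ 4 * z₁ t) ^ 2 + 1) ^ (3 / 2 : ℝ)) 0 :=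
    SmoothGerm.div (by fun_prop) hE (by simp)
  have hpc : planarCurvature c =ᶠ[𝓝 0] fun t => t ^ 3 *
      (-(((3 : ℕ) + 1) * z₁ t + t * deriv z₁ t) / ((t ^ 4 * z₁ t) ^ 2 + 1) ^ (3 / 2 : ℝ)) := by
    filter_upwards [planarCurvature_eventuallyEq hc, h1, h2] with t e1 e2 e3
    rw [e1, e2, e3]
    ring
  -- The constant is `3! · (5 · 4)`, where `5 · 4` comes from the second derivative of `t ^ 5`.
  rw [hpc.iteratedDeriv_eq, (iteratedDeriv_pow_mul hz 3).2]
  simp [hz₁, Nat.factorial]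
  ring

end PlanarCurvature

/-! ### Orders under a change of parameter -/

section Reparametrization

theorem exists_hasRationalOrder_of_unit_mul_comp {h U D z σ g₂ g₃ : ℝ → ℝ} {k n₂ n₃ : ℕ}
    (hU : SmoothGerm U 0) (hU0 : U 0 ≠ 0) (hσ : SmoothGerm σ 0) (hσ0 : σ 0 = 0)
    (hσ' : deriv σ 0 ≠ 0) (hD : SmoothGerm D 0) (hz : SmoothGerm z 0)
    (hDz : D =ᶠ[𝓝 0] fun t => t ^ k * z t) (h₂ : SmoothGerm g₂ 0) (h₃ : SmoothGerm g₃ 0)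
    (ho₂ : germOrder g₂ = n₂) (ho₃ : germOrder g₃ = n₃)
    (hh : ∀ᶠ r in 𝓝[≠] 0, h r = U r * D (σ r) / (|g₂ r| * g₃ r)) :
    ∃ o, HasRationalOrder h o ∧ (((k : ℤ) - n₂ - n₃ : ℤ) : WithTop ℤ) ≤ o ∧
      (o = (((k : ℤ) - n₂ - n₃ : ℤ) : WithTop ℤ) ↔ z 0 ≠ 0) := by
  -- With `σ = r ρ` and `ρ(0) = σ'(0) ≠ 0`, the factor `σ ^ k` is `r ^ k` times a unit, so the order
  -- is unchanged.
  obtain ⟨ρ, hρ, hσρ⟩ := hσ.exists_eq_mul hσ0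
  have hρ0 : ρ 0 ≠ 0 := by
    have e' : σ =ᶠ[𝓝 0] fun t => t ^ (0 + 1) * ρ t := hσρ.mono fun t ht => by simp [ht]
    have e := (deriv_eventuallyEq_of_eq_pow_mul hρ e').eq_of_nhds
    simp at e
    rwa [← e]
  have hDσ : SmoothGerm (fun r => D (σ r)) 0 := SmoothGerm.comp (by rwa [hσ0]) hσ
  have hzσ : SmoothGerm (fun r => z (σ r)) 0 := SmoothGerm.comp (by rwa [hσ0]) hσ
  have hσt : Tendsto σ (𝓝 0) (𝓝 0) := by
    have := hσ.continuousAt.tendsto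
    rwa [hσ0] at this
  obtain ⟨o, h1, h2, h3⟩ := exists_hasRationalOrder (k := k)
    (z := fun r => U r * ρ r ^ k * z (σ r)) (hU.mul hDσ) h₂ h₃ hh ho₂ ho₃ ((hU.mul (hρ.pow k)).mul hzσ) (by
      filter_upwards [hσt.eventually hDz, hσρ] with r e1 e2
      rw [e1]
      nth_rw 1 [e2]
      ring)
  refine ⟨o, h1, h2, h3.trans ?_⟩
  simp [hσ0, hU0, hρ0]

theorem germOrder_eq_one {σ : ℝ → ℝ} (hσ0 : σ 0 = 0) (hσ' : deriv σ 0 ≠ 0) :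
    germOrder σ = (1 : ℕ) := by
  refine germOrder_eq_natCast_iff.2 ⟨fun k hk => ?_, by rwa [iteratedDeriv_one]⟩
  obtain rfl : k = 0 := by omega
  simpa using hσ0

theorem germOrder_one : germOrder (fun _ => (1 : ℝ)) = (0 : ℕ) :=
  germOrder_eq_natCast_iff.2 ⟨fun k hk => absurd hk (by omega), by simp⟩

end Reparametrization

theorem SmoothGerm.norm {E F : Type*} [NormedAddCommGroup E] [NormedSpace ℝ E]
    [NormedAddCommGroup F] [InnerProductSpace ℝ F] {x : E} {g : E → F} (hg : SmoothGerm g x)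
    (h0 : g x ≠ 0) : SmoothGerm (fun y => ‖g y‖) x := by
  filter_upwards [hg, hg.continuousAt.eventually_ne h0] with y h1 h2 using h1.norm ℝ h2

theorem hasDerivAt_vec3 {g₁ g₂ g₃ : ℝ → ℝ} {d₁ d₂ d₃ t : ℝ} (h₁ : HasDerivAt g₁ d₁ t)
    (h₂ : HasDerivAt g₂ d₂ t) (h₃ : HasDerivAt g₃ d₃ t) :
    HasDerivAt (fun t => (!₂[g₁ t, g₂ t, g₃ t] : E3)) (!₂[d₁, d₂, d₃] : E3) t := by
  have h : HasDerivAt (fun t => ![g₁ t, g₂ t, g₃ t]) ![d₁, d₂, d₃] t := by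
    refine hasDerivAt_pi.2 fun i => ?_
    fin_cases i <;> assumption
  exact (PiLp.continuousLinearEquiv 2 ℝ fun _ : Fin 3 => ℝ).symm.hasFDerivAt.comp_hasDerivAt t h

/-! ### Curvatures of a curve with velocity `t w(t)` -/

section Frame

variable {f ν : ℝ × ℝ → E3} {γ : ℝ → ℝ × ℝ} {L : E3 ≃ₗᵢ[ℝ] E3} {G w w' N N' : ℝ → E3}
  {σ e : ℝ → ℝ}

/-- The curvatures of a curve on a surface with singular velocity `t w(t)` and normal direction
`N`, after a reparametrization `σ`. -/
theorem curvatures_eq (hL : ∀ x y z : E3, det3 (L x) (L y) (L z) = det3 x y z)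
    (hσ : SmoothGerm σ 0) (hσ0 : σ 0 = 0) (hσ' : deriv σ 0 ≠ 0) (he : SmoothGerm e 0)
    (hG : ∀ᶠ t in 𝓝 0, HasDerivAt G (t • w t) t) (hw : ∀ᶠ t in 𝓝 0, HasDerivAt w (w' t) t)
    (hN : ∀ᶠ t in 𝓝 0, HasDerivAt N (N' t) t) (hw0 : ∀ t, w t ≠ 0)
    (horth : ∀ t, inner ℝ (w t) (N t) = 0)
    (hf : f ∘ γ =ᶠ[𝓝 0] fun r => L (G (σ r)))
    (hν : ∀ᶠ r in 𝓝[≠] 0, ν (γ r) = e r • L (N (σ r))) :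
    ∀ᶠ r in 𝓝[≠] 0,
      geodesicCurvature f ν γ r = deriv σ r ^ 3 * e r / (|deriv σ r| ^ 3 * ‖w (σ r)‖ ^ 3) *
        det3 (w (σ r)) (w' (σ r)) (N (σ r)) / (|σ r| * 1) ∧
      normalCurvature f ν γ r = e r / ‖w (σ r)‖ ^ 2 * inner ℝ (w' (σ r)) (N (σ r)) /
        (|1| * σ r) ∧
      geodesicTorsion f ν γ r = e r ^ 2 / ‖w (σ r)‖ ^ 2 *
        det3 (w (σ r)) (N (σ r)) (N' (σ r)) / (|1| * σ r) := by
  have hσt : Tendsto σ (𝓝 0) (𝓝 0) := by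
    have := hσ.continuousAt.tendsto
    rwa [hσ0] at this
  have hσne : ∀ᶠ r in 𝓝[≠] 0, σ r ≠ 0 := by
    simpa [hσ0] using hσ.hasDerivAt.eventually_ne (c := 0) hσ'
  have h1 : deriv (f ∘ γ) =ᶠ[𝓝 0] fun r => L ((deriv σ r * σ r) • w (σ r)) := by
    filter_upwards [hf.eventuallyEq_nhds, hσ.eventually_hasDerivAt, hσt.eventually hG]
      with r e1 e2 e3
    have e4 := L.toContinuousLinearEquiv.hasFDerivAt.comp_hasDerivAt r (e3.scomp r e2)
    rw [e1.deriv_eq]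
    refine (HasDerivAt.deriv (f := fun r => L (G (σ r))) e4).trans ?_
    rw [smul_smul]
    rfl
  have hs1 : SmoothGerm (fun r => deriv σ r * σ r) 0 := hσ.deriv.mul hσ
  have h2 : ∀ᶠ r in 𝓝 0, iteratedDeriv 2 (f ∘ γ) r =
      L (deriv (fun r => deriv σ r * σ r) r • w (σ r) + (deriv σ r ^ 2 * σ r) • w' (σ r)) := by
    filter_upwards [h1.eventuallyEq_nhds, hσ.eventually_hasDerivAt, hσt.eventually hw,
      hs1.eventually_hasDerivAt] with r e1 e2 e3 e5
    have e4 := L.toContinuousLinearEquiv.hasFDerivAt.comp_hasDerivAt r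
      (e5.smul (e3.scomp r e2))
    rw [iteratedDeriv_succ, iteratedDeriv_one, e1.deriv_eq]
    refine (HasDerivAt.deriv (f := fun r => L ((deriv σ r * σ r) • w (σ r))) e4).trans ?_
    change L _ = L _
    congr 1
    rw [smul_smul, add_comm]
    congr 2
    ring
  have h3 : ∀ᶠ r in 𝓝[≠] 0, deriv (ν ∘ γ) r =
      L (deriv e r • N (σ r) + (e r * deriv σ r) • N' (σ r)) := by
    filter_upwards [eventually_eventually_nhdsWithin.2 hν, nhdsWithin_le_nhds
      hσ.eventually_hasDerivAt, nhdsWithin_le_nhds (hσt.eventually hN), nhdsWithin_le_nhds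
      he.eventually_hasDerivAt, self_mem_nhdsWithin] with r e1 e2 e3 e5 hr
    have e6 : ν ∘ γ =ᶠ[𝓝 r] fun r => L (e r • N (σ r)) := by
      rw [isOpen_compl_singleton.nhdsWithin_eq hr] at e1
      filter_upwards [e1] with s hs
      rw [Function.comp_apply, hs, map_smul]
    have e4 := L.toContinuousLinearEquiv.hasFDerivAt.comp_hasDerivAt r
      (e5.smul (e3.scomp r e2))
    rw [e6.deriv_eq]
    refine (HasDerivAt.deriv (f := fun r => L (e r • N (σ r))) e4).trans ?_
    change L _ = L _
    congr 1
    rw [smul_smul, add_comm, Function.comp_apply]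
  filter_upwards [hσne, hν, nhdsWithin_le_nhds h1, nhdsWithin_le_nhds h2, h3,
    nhdsWithin_le_nhds (hσ.deriv.continuousAt.eventually_ne hσ')] with r i1 i2 i3 i4 i5 i6
  have i7 : ‖w (σ r)‖ ≠ 0 := norm_ne_zero_iff.2 (hw0 _)
  have i8 := horth (σ r)
  rw [geodesicCurvature, normalCurvature, geodesicTorsion, i3, i4, i5, i2, ← map_smul, hL, hL,
    L.inner_map_map, L.norm_map, norm_smul, Real.norm_eq_abs, abs_mul]
  have j1 : |deriv σ r| ≠ 0 := abs_ne_zero.2 i6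
  have j2 : |σ r| ≠ 0 := abs_ne_zero.2 i1
  have k1 : |deriv σ r| ^ 2 = deriv σ r ^ 2 := sq_abs _
  have k2 : |σ r| ^ 2 = σ r ^ 2 := sq_abs _
  refine ⟨?_, ?_, ?_⟩
  -- The part of the acceleration along `w` drops out. Writing `σ²` as `|σ|²` lets it cancel against
  -- `|σ|³`, which leaves the single `|σ|` that belongs in the factor `|g₂|` of a rational order.
  · have : det3 ((deriv σ r * σ r) • w (σ r)) (deriv (fun r => deriv σ r * σ r) r • w (σ r) +
        (deriv σ r ^ 2 * σ r) • w' (σ r)) (e r • N (σ r)) =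
        deriv σ r ^ 3 * |σ r| ^ 2 * e r * det3 (w (σ r)) (w' (σ r)) (N (σ r)) := by
      rw [k2]
      simp only [det3_eq, PiLp.add_apply, PiLp.smul_apply, smul_eq_mul]
      ring
    rw [this]
    field_simp
  · rw [inner_add_left, real_inner_smul_left, real_inner_smul_left, real_inner_smul_right,
      real_inner_smul_right, i8, mul_pow, mul_pow, k1, k2, abs_one]
    field_simp
    ring
  · have : det3 ((deriv σ r * σ r) • w (σ r)) (e r • N (σ r)) (deriv e r • N (σ r) +
        (e r * deriv σ r) • N' (σ r)) =
        deriv σ r ^ 2 * σ r * e r ^ 2 * det3 (w (σ r)) (N (σ r)) (N' (σ r)) := by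
      simp only [det3_eq, PiLp.add_apply, PiLp.smul_apply, smul_eq_mul]
      ring
    rw [this, mul_pow, mul_pow, k1, k2, abs_one]
    field_simp

end Frame

/-! ### Comparison of the unit normal with the normal direction -/

/-- The normal direction of the normal form. -/
noncomputable def edgeNormal (a b₀ : ℝ → ℝ) (b : ℝ × ℝ → ℝ) (q : ℝ × ℝ) : E3 :=
  !₂[edgeAlpha a q * edgeB b q - edgeBeta b₀ b q, -edgeB b q, 1]

namespace EdgeNormalized

variable {f ν : ℝ × ℝ → E3} {L : E3 ≃ₗᵢ[ℝ] E3} {Θ Θinv : ℝ × ℝ → ℝ × ℝ} {a b₀ : ℝ → ℝ}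
  {b : ℝ × ℝ → ℝ}

theorem eventually_comp_inv (h : EdgeNormalized f L Θ Θinv a b₀ b) :
    (fun q => f (Θinv q)) =ᶠ[𝓝 0] fun q => L (edgeNormalForm a b₀ b q) := by
  filter_upwards [h.diffeo.symm.tendsto.eventually h.eq_comp, h.diffeo.right_inv] with q h1 h2
  rw [h1, h2]

theorem eventually_unitNormal_eq (h : EdgeNormalized f L Θ Θinv a b₀ b) (hν : IsUnitNormal f ν) :
    ∀ᶠ q in 𝓝 (0 : ℝ × ℝ), q.2 ≠ 0 →
      ν (Θinv q) = L.symm (ν (Θinv q)) 2 • L (edgeNormal a b₀ b q) := by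
  have hfd : ∀ᶠ p in 𝓝 (0 : ℝ × ℝ), DifferentiableAt ℝ f p := by
    have : SmoothGerm f 0 := by
      refine SmoothGerm.congr ?_ h.eq_comp
      refine SmoothGerm.comp (.of_contDiff L.contDiff) (SmoothGerm.comp ?_ h.diffeo.smooth)
      rw [h.diffeo.map_zero]
      exact h.smooth_normalForm
    exact this.eventually_differentiableAt
  filter_upwards [h.eventually_comp_inv.eventuallyEq_nhds,
    h.diffeo.smooth_inv.eventually_differentiableAt,
    h.smooth_normalForm.eventually_differentiableAt,
    h.diffeo.symm.tendsto.eventually hfd, h.diffeo.symm.tendsto.eventually hν.orthogonal,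
    h.eventually_fderiv_normalForm] with q h1 h2 h3 h4 h5 h6 hq
  set n := L.symm (ν (Θinv q)) with hn
  have hLn : ν (Θinv q) = L n := by simp [hn]
  have e1 := (h4.hasFDerivAt.comp q h2.hasFDerivAt).unique
    ((L.toContinuousLinearEquiv.hasFDerivAt.comp q h3.hasFDerivAt).congr_of_eventuallyEq h1)
  have key (Y : ℝ × ℝ) : inner ℝ (fderiv ℝ (edgeNormalForm a b₀ b) q Y) n = 0 := by
    have e2 := h5 (fderiv ℝ Θinv q Y)
    have e3 : fderiv ℝ f (Θinv q) (fderiv ℝ Θinv q Y) =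
        L (fderiv ℝ (edgeNormalForm a b₀ b) q Y) := congrArg (fun T => T Y) e1
    rw [e3, hLn, L.inner_map_map] at e2
    exact e2
  have comp (Y : ℝ × ℝ) (i : Fin 3) : fderiv ℝ (edgeNormalForm a b₀ b) q Y i =
      fderiv ℝ (fun q => edgeNormalForm a b₀ b q i) q Y :=
    dirD_apply (ζ := fun _ => Y) h3 i
  have k1 := key (1, 0)
  have k2 := key (0, 1)
  rw [inner_eq_sum_three, comp, comp, comp, (h6 _).1, (h6 _).2.1, (h6 _).2.2] at k1 k2
  simp only [one_mul, zero_mul, mul_one, add_zero, zero_add] at k1 k2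
  -- The `v`-derivative is `v (0, 1, B)`, so orthogonality to `(0, 1, B)` follows only after
  -- division by `v`; hence the restriction to `q.2 ≠ 0`.
  have k3 : n 1 = -edgeB b q * n 2 := by
    have : q.2 * (n 1 + edgeB b q * n 2) = 0 := by linarith
    rcases mul_eq_zero.1 this with h0 | h0
    · exact absurd h0 hq
    · linarith
  rw [k3] at k1
  rw [hLn, ← map_smul]
  congr 1
  ext i
  fin_cases i
  · simp [edgeNormal]
    linarith
  · simp [edgeNormal, k3, mul_comm]
  · simp [edgeNormal]

end EdgeNormalized

/-! ### The normal form along the curve `(x(t), t)` -/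

section AlongCurve

variable {a b₀ : ℝ → ℝ} {b : ℝ × ℝ → ℝ} {x X : ℝ → ℝ}

theorem SmoothGerm.comp_graph {E : Type*} [NormedAddCommGroup E] [NormedSpace ℝ E]
    {g : ℝ × ℝ → E} (hg : SmoothGerm g 0) (hx : SmoothGerm x 0) (hx0 : x 0 = 0) :
    SmoothGerm (fun t => g (x t, t)) 0 :=
  SmoothGerm.comp (by rw [hx0]; exact hg) (hx.prodMk .id)

/-- Factorizations of the coefficients of the normal form along the curve `(x(t), t)`. -/
theorem exists_coefficients_along (ha : SmoothGerm a 0) (hb₀ : SmoothGerm b₀ 0)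
    (hb : SmoothGerm b 0) (hb0 : b 0 = 0) (hx : SmoothGerm x 0) (hX : SmoothGerm X 0)
    (hxX : x =ᶠ[𝓝 0] fun t => t ^ 2 * X t) :
    ∃ α₂ β₂ B₁ : ℝ → ℝ, SmoothGerm α₂ 0 ∧ SmoothGerm β₂ 0 ∧ SmoothGerm B₁ 0 ∧
      (fun t => edgeAlpha a (x t, t)) =ᶠ[𝓝 0] (fun t => t ^ 2 * α₂ t) ∧
      (fun t => edgeBeta b₀ b (x t, t)) =ᶠ[𝓝 0] (fun t => t ^ 2 * β₂ t) ∧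
      (fun t => edgeB b (x t, t)) =ᶠ[𝓝 0] (fun t => t ^ 1 * B₁ t) ∧
      β₂ 0 = X 0 * b₀ 0 + fderiv ℝ b 0 (1, 0) / 2 ∧ B₁ 0 = 3 / 2 * fderiv ℝ b 0 (0, 1) := by
  have hx0 : x 0 = 0 := by simpa using hxX.eq_of_nhds
  have c1 : SmoothGerm (fun t => a (x t)) 0 := SmoothGerm.comp (by rwa [hx0]) hx
  have c2 : SmoothGerm (fun t => deriv a (x t)) 0 := SmoothGerm.comp (by rw [hx0]; exact ha.deriv) hx
  have c3 : SmoothGerm (fun t => b₀ (x t)) 0 := SmoothGerm.comp (by rwa [hx0]) hx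
  have c4 : SmoothGerm (fun t => deriv b₀ (x t)) 0 :=
    SmoothGerm.comp (by rw [hx0]; exact hb₀.deriv) hx
  have c5 : SmoothGerm (fun t => fderiv ℝ b (x t, t) (1, 0)) 0 :=
    SmoothGerm.comp_graph (g := fun q => fderiv ℝ b q (1, 0)) (by fun_prop) hx hx0
  have c6 : SmoothGerm (fun t => edgeB b (x t, t)) 0 := hb.edgeB.comp_graph hx hx0
  obtain ⟨B₁, hB₁, hBB⟩ := c6.exists_eq_mul (by
    rw [hx0]; exact edgeB_zero hb0)
  have hBB' : (fun t => edgeB b (x t, t)) =ᶠ[𝓝 0] (fun t => t ^ (0 + 1) * B₁ t) :=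
    hBB.mono fun t ht => by simp [ht]
  refine ⟨fun t => X t * (a (x t) + x t * deriv a (x t) / 2),
    fun t => X t * (b₀ (x t) + x t * deriv b₀ (x t) / 2) + fderiv ℝ b (x t, t) (1, 0) / 2, B₁,
    hX.mul (c1.add ((hx.mul c2).div_const 2)),
    (hX.mul (c3.add ((hx.mul c4).div_const 2))).add (c5.div_const 2), hB₁, ?_, ?_, hBB', ?_, ?_⟩
  · filter_upwards [hxX] with t ht
    simp only [edgeAlpha]
    nth_rw 1 [ht]
    ring
  · filter_upwards [hxX] with t ht
    simp only [edgeBeta]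
    nth_rw 1 [ht]
    ring
  · simp only [hx0, zero_mul, zero_div, add_zero]
    rfl
  -- `B₁(0)` is the derivative of `B` along the curve at `0`, which is purely in the `v`-direction
  -- since `x'(0) = 0`.
  · have e1 := (deriv_eventuallyEq_of_eq_pow_mul hB₁ hBB').eq_of_nhds
    have e2 : deriv x 0 = 0 := by
      simpa using (deriv_eventuallyEq_of_eq_pow_mul (n := 1) hX hxX).eq_of_nhds
    have e3 : HasFDerivAt (edgeB b) (fderiv ℝ (edgeB b) 0) (x 0, (0 : ℝ)) := by
      rw [hx0]; exact hb.edgeB.differentiableAt.hasFDerivAt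
    have e4 := e3.comp_hasDerivAt (f := fun t => (x t, t)) (0 : ℝ) (hx.hasDerivAt.prodMk (hasDerivAt_id (0 : ℝ)))
    have e5 : deriv (fun t => edgeB b (x t, t)) 0 = _ := e4.deriv
    rw [e5, e2, (fderiv_edgeB hb).2] at e1
    simpa using e1.symm

/-- The velocity is divisible by `t` for two reasons at once: `x' = t y`, and the `v`-derivative of
the normal form carries the factor `v = t`. -/
theorem hasDerivAt_edgeNormalForm_along (ha : SmoothGerm a 0) (hb₀ : SmoothGerm b₀ 0)
    (hb : SmoothGerm b 0) (hx : SmoothGerm x 0) (hX : SmoothGerm X 0)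
    (hxX : x =ᶠ[𝓝 0] fun t => t ^ 2 * X t) :
    ∀ᶠ t in 𝓝 0, HasDerivAt (fun t => edgeNormalForm a b₀ b (x t, t))
      (t • (!₂[2 * X t + t * deriv X t,
        1 + (2 * X t + t * deriv X t) * edgeAlpha a (x t, t),
        (2 * X t + t * deriv X t) * edgeBeta b₀ b (x t, t) + edgeB b (x t, t)] : E3)) t := by
  have hx0 : x 0 = 0 := by simpa using hxX.eq_of_nhds
  have hxt : Tendsto x (𝓝 0) (𝓝 0) := by
    have := hx.continuousAt.tendsto
    rwa [hx0] at this
  have hxt' : Tendsto (fun t => (x t, t)) (𝓝 0) (𝓝 0) := by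
    exact hxt.prodMk_nhds (tendsto_id (x := 𝓝 (0 : ℝ)))
  filter_upwards [hxt.eventually ha.eventually_differentiableAt,
    hxt.eventually hb₀.eventually_differentiableAt, hxt'.eventually hb.eventually_differentiableAt,
    hx.eventually_hasDerivAt, deriv_eventuallyEq_of_eq_pow_mul (n := 1) hX hxX]
    with t h1 h2 h3 h4 h5
  have h6 : deriv x t = t * (2 * X t + t * deriv X t) := by
    rw [h5]; push_cast; ring
  obtain ⟨e1, e2, e3⟩ := fderiv_edgeNormalForm (q := (x t, t)) h1 h2 h3
  have hp := h4.prodMk (hasDerivAt_id t)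
  have d1 := e1.comp_hasDerivAt (f := fun t => (x t, t)) t hp
  have d2 := e2.1.hasFDerivAt.comp_hasDerivAt (f := fun t => (x t, t)) t hp
  have d3 := e3.1.hasFDerivAt.comp_hasDerivAt (f := fun t => (x t, t)) t hp
  rw [e2.2] at d2
  rw [e3.2] at d3
  refine (hasDerivAt_vec3 d1 d2 d3).congr_deriv ?_
  ext i
  fin_cases i
  · simp [h6]; try ring
  · simp [h6]; try ring
  · simp [h6]; try ring

end AlongCurve

namespace EdgeNormalized

variable {f ν : ℝ × ℝ → E3} {L : E3 ≃ₗᵢ[ℝ] E3} {Θ Θinv : ℝ × ℝ → ℝ × ℝ} {a b₀ : ℝ → ℝ}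
  {b : ℝ × ℝ → ℝ} {γ γt : ℝ → ℝ × ℝ} {x X : ℝ → ℝ}

/-- The curvatures of `f ∘ γ` as a unit times the reduced functions of the normal parameter, divided
by the parameter. -/
theorem exists_curvatures_eq (h : EdgeNormalized f L Θ Θinv a b₀ b) (hν : IsUnitNormal f ν)
    (hγ : SmoothGerm γ 0) (hγ0 : γ 0 = 0) (hγt : IsNormalParam Θ γ γt)
    (hx : SmoothGerm x 0) (hX : SmoothGerm X 0) (hxX : x =ᶠ[𝓝 0] fun t => t ^ 2 * X t)
    (hxγ : ∀ᶠ t in 𝓝 0, γt t = (x t, t)) :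
    ∃ σ U₁ U₂ U₃ : ℝ → ℝ, SmoothGerm σ 0 ∧ σ 0 = 0 ∧ deriv σ 0 ≠ 0 ∧
      SmoothGerm U₁ 0 ∧ SmoothGerm U₂ 0 ∧ SmoothGerm U₃ 0 ∧ U₁ 0 ≠ 0 ∧ U₂ 0 ≠ 0 ∧ U₃ 0 ≠ 0 ∧
      ∀ᶠ r in 𝓝[≠] 0,
        geodesicCurvature f ν γ r = U₁ r * reducedGeodesic (fun t => 2 * X t + t * deriv X t)
          (fun t => edgeAlpha a (x t, t)) (fun t => edgeBeta b₀ b (x t, t))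
          (fun t => edgeB b (x t, t)) (σ r) / (|σ r| * 1) ∧
        normalCurvature f ν γ r = U₂ r * reducedNormal (fun t => 2 * X t + t * deriv X t)
          (fun t => edgeAlpha a (x t, t)) (fun t => edgeBeta b₀ b (x t, t))
          (fun t => edgeB b (x t, t)) (σ r) / (|1| * σ r) ∧
        geodesicTorsion f ν γ r = U₃ r * reducedTorsion (fun t => 2 * X t + t * deriv X t)
          (fun t => edgeAlpha a (x t, t)) (fun t => edgeBeta b₀ b (x t, t))
          (fun t => edgeB b (x t, t)) (σ r) / (|1| * σ r) := by
  obtain ⟨s, σ, hs, hsγ⟩ := hγt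
  have hx0 : x 0 = 0 := by simpa using hxX.eq_of_nhds
  have hσ := hs.smooth_inv
  have hσ0 := hs.inv_zero
  have hσ' : deriv σ 0 ≠ 0 := by
    intro h0
    have e : Function.Injective (fderiv ℝ σ 0) := hs.symm.eventually_injective.self_of_nhds
    have e1 : fderiv ℝ σ 0 1 = fderiv ℝ σ 0 0 := by
      rw [map_zero, fderiv_apply_one_eq_deriv, h0]
    exact one_ne_zero (e e1)
  have hσt : Tendsto σ (𝓝 0) (𝓝 0) := hs.symm.tendsto
  have hγΘ : ∀ᶠ r in 𝓝 0, γ r = Θinv (x (σ r), σ r) := by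
    have hγt0 : Tendsto γ (𝓝 0) (𝓝 0) := by
      have := hγ.continuousAt.tendsto
      rwa [hγ0] at this
    filter_upwards [hσt.eventually hsγ, hσt.eventually hxγ, hs.right_inv,
      hγt0.eventually h.diffeo.left_inv] with r e1 e2 e3 e4
    rw [← e2, ← e1.1, e3, e4]
  have hxσ : Tendsto (fun r => (x (σ r), σ r)) (𝓝 0) (𝓝 0) := by
    have e : SmoothGerm (fun t => (x t, t)) 0 := hx.prodMk .id
    have := e.continuousAt.tendsto
    rw [hx0] at this
    exact this.comp hσt
  set y : ℝ → ℝ := fun t => 2 * X t + t * deriv X t with hy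
  set α : ℝ → ℝ := fun t => edgeAlpha a (x t, t) with hα
  set β : ℝ → ℝ := fun t => edgeBeta b₀ b (x t, t) with hβ
  set B : ℝ → ℝ := fun t => edgeB b (x t, t) with hB
  have sX := hX.deriv
  have sy : SmoothGerm y 0 := by fun_prop
  have sα : SmoothGerm α 0 := h.smooth_a.edgeAlpha.comp_graph hx hx0
  have sβ : SmoothGerm β 0 := (SmoothGerm.edgeBeta h.smooth_b₀ h.smooth_b).comp_graph hx hx0
  have sB : SmoothGerm B 0 := h.smooth_b.edgeB.comp_graph hx hx0
  set w : ℝ → E3 := fun t => !₂[y t, 1 + y t * α t, y t * β t + B t] with hw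
  set w' : ℝ → E3 := fun t => !₂[deriv y t, deriv y t * α t + y t * deriv α t,
    deriv y t * β t + y t * deriv β t + deriv B t] with hw'
  set N : ℝ → E3 := fun t => !₂[α t * B t - β t, -B t, 1] with hN
  set N' : ℝ → E3 := fun t =>
    !₂[deriv α t * B t + α t * deriv B t - deriv β t, -deriv B t, 0] with hN'
  have sw : SmoothGerm w 0 := smoothGerm_vec3 sy (by fun_prop) (by fun_prop)
  have sN : SmoothGerm N 0 := smoothGerm_vec3 (by fun_prop) (by fun_prop) (by fun_prop)
  have dw : ∀ᶠ t in 𝓝 0, HasDerivAt w (w' t) t := by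
    filter_upwards [sy.eventually_hasDerivAt, sα.eventually_hasDerivAt, sβ.eventually_hasDerivAt,
      sB.eventually_hasDerivAt] with t e1 e2 e3 e4
    exact hasDerivAt_vec3 e1 ((e1.mul e2).const_add 1) ((e1.mul e3).add e4)
  have dN : ∀ᶠ t in 𝓝 0, HasDerivAt N (N' t) t := by
    filter_upwards [sα.eventually_hasDerivAt, sβ.eventually_hasDerivAt,
      sB.eventually_hasDerivAt] with t e2 e3 e4
    exact hasDerivAt_vec3 ((e2.mul e4).sub e3) e4.neg (hasDerivAt_const t 1)
  have hw0 (t : ℝ) : w t ≠ 0 := by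
    intro e
    have e0 : y t = 0 := congrArg (fun v : E3 => v 0) e
    have e1 : 1 + y t * α t = 0 := congrArg (fun v : E3 => v 1) e
    simp [e0] at e1
  have horth (t : ℝ) : inner ℝ (w t) (N t) = 0 := by
    rw [inner_eq_sum_three]
    simp [hw, hN]
    ring
  set e : ℝ → ℝ := fun r => L.symm (ν (γ r)) 2 with he
  have se : SmoothGerm e 0 := by
    refine SmoothGerm.apply_euclidean (f := fun r => L.symm (ν (γ r))) ?_ 2
    exact SmoothGerm.comp (.of_contDiff L.symm.contDiff)
      (SmoothGerm.comp (by rw [hγ0]; exact hν.smooth) hγ)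
  have hσne : ∀ᶠ r in 𝓝[≠] 0, σ r ≠ 0 := by
    simpa [hσ0] using hσ.hasDerivAt.eventually_ne (c := 0) hσ'
  have hνN : ∀ᶠ r in 𝓝[≠] 0, ν (γ r) = e r • L (N (σ r)) := by
    filter_upwards [hσne, nhdsWithin_le_nhds hγΘ,
      nhdsWithin_le_nhds (hxσ.eventually (h.eventually_unitNormal_eq hν))] with r e1 e2 e3
    have e4 := e3 e1
    rw [← e2] at e4
    exact e4
  -- The relation with `N` is known only off `0`. There the multiple `e N` has norm `1`, so letting
  -- `r → 0` excludes `e 0 = 0`.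
  have he0 : e 0 ≠ 0 := by
    intro h0
    have hγt0 : Tendsto γ (𝓝 0) (𝓝 0) := by
      have := hγ.continuousAt.tendsto
      rwa [hγ0] at this
    have hNσ : SmoothGerm (fun r => N (σ r)) 0 := SmoothGerm.comp (by rwa [hσ0]) hσ
    have e1 : Tendsto (fun r => e r • N (σ r)) (𝓝[≠] 0) (𝓝 (e 0 • N (σ 0))) :=
      ((se.smul hNσ).continuousAt.tendsto).mono_left nhdsWithin_le_nhds
    have e2 := e1.norm
    rw [h0, zero_smul, norm_zero] at e2
    have e3 : (fun r => ‖e r • N (σ r)‖) =ᶠ[𝓝[≠] 0] fun _ => 1 := by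
      filter_upwards [hνN, nhdsWithin_le_nhds (hγt0.eventually hν.norm_eq_one)] with r i1 i2
      rw [← i2, i1, ← map_smul, L.norm_map]
    exact zero_ne_one (tendsto_nhds_unique (e2.congr' e3) tendsto_const_nhds)
  have hfγ : f ∘ γ =ᶠ[𝓝 0] fun r => L ((fun t => edgeNormalForm a b₀ b (x t, t)) (σ r)) := by
    filter_upwards [hγΘ, hxσ.eventually h.eventually_comp_inv] with r e1 e2
    rw [Function.comp_apply, e1, e2]
  have key := curvatures_eq h.det3_map hσ hσ0 hσ' se
    (hasDerivAt_edgeNormalForm_along h.smooth_a h.smooth_b₀ h.smooth_b hx hX hxX) dw dN hw0 horth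
    hfγ hνN
  have swσ : SmoothGerm (fun r => ‖w (σ r)‖) 0 :=
    SmoothGerm.norm (SmoothGerm.comp (by rwa [hσ0]) hσ) (hw0 _)
  have hwσ : ‖w (σ 0)‖ ≠ 0 := norm_ne_zero_iff.2 (hw0 _)
  have sσ' := hσ.deriv
  have sσa := sσ'.abs hσ'
  have hσa : |deriv σ 0| ≠ 0 := abs_ne_zero.2 hσ'
  refine ⟨σ, fun r => deriv σ r ^ 3 * e r / (|deriv σ r| ^ 3 * ‖w (σ r)‖ ^ 3),
    fun r => e r / ‖w (σ r)‖ ^ 2, fun r => e r ^ 2 / ‖w (σ r)‖ ^ 2, hσ, hσ0, hσ',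
    SmoothGerm.div (by fun_prop) ((sσa.pow 3).mul (swσ.pow 3)) (by positivity),
    SmoothGerm.div se (swσ.pow 2) (by positivity),
    SmoothGerm.div (se.pow 2) (swσ.pow 2) (by positivity),
    by positivity, by positivity, by positivity, key.mono fun r hr => ?_⟩
  refine ⟨hr.1.trans ?_, hr.2.1.trans ?_, hr.2.2.trans ?_⟩
  · congr 2
    rw [det3_eq, reducedGeodesic]
    simp [hw', hN]
    ring
  · congr 2
    rw [inner_eq_sum_three, reducedNormal]
    simp [hw', hN]
    ring
  · congr 2
    rw [det3_eq, reducedTorsion]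
    simp [hN, hN']
    ring

end EdgeNormalized

/-! ### Assembly of the cases -/

theorem mainTheorem9
    (f : ℝ × ℝ → E3) (hf : IsCuspidalEdge f)
    (ν : ℝ × ℝ → E3) (hν : IsUnitNormal f ν)
    (μ : ℝ → ℝ × ℝ) (ξ η : ℝ × ℝ → ℝ × ℝ) (hξη : IsAdaptedPair 2 f μ ξ η)
    (κt wc : ℝ) (hκt : κt = cuspidalTorsion 2 f ξ η μ 0)
    (hwc : wc = cuspidalCurvature 2 f ξ η μ 0)
    (A : Matrix.specialOrthogonalGroup (Fin 3) ℝ) (Θ Θinv : ℝ × ℝ → ℝ × ℝ)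
    (hΘ : IsNormalFormChart 2 f A Θ Θinv)
    (γ : ℝ → ℝ × ℝ) (hγ : SmoothGerm γ 0) (hγ0 : γ 0 = 0) (hγreg : deriv γ 0 ≠ 0)
    (γt : ℝ → ℝ × ℝ) (hγt : IsNormalParam Θ γ γt)
    (l : ℕ) (hl : 2 ≤ l) (hcontact : germOrder (fun t => (γt t).1) = l) :
    -- the geodesic curvature
    (l = 2 → ∃ o, HasRationalOrder (geodesicCurvature f ν γ) o ∧ ((-1 : ℤ) : WithTop ℤ) ≤ o ∧
      (o = ((-1 : ℤ) : WithTop ℤ) ↔ iteratedDeriv (l - 1) (planarCurvature γt) 0 ≠ 0)) ∧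
    (l = 3 ∨ l = 4 →
      HasRationalOrder (geodesicCurvature f ν γ) (((l : ℤ) - 4 : ℤ) : WithTop ℤ)) ∧
    (5 ≤ l → ∃ o, HasRationalOrder (geodesicCurvature f ν γ) o ∧ ((1 : ℤ) : WithTop ℤ) ≤ o ∧
      (l = 5 → (o = ((1 : ℤ) : WithTop ℤ) ↔
        ((l - 1)! : ℝ) * κt * wc - 12 * iteratedDeriv (l - 2) (planarCurvature γt) 0 ≠ 0)) ∧
      (5 < l → (o = ((1 : ℤ) : WithTop ℤ) ↔ κt * wc ≠ 0))) ∧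
    -- the normal curvature
    HasRationalOrder (normalCurvature f ν γ) ((-1 : ℤ) : WithTop ℤ) ∧
    -- the geodesic torsion
    (l = 2 ∨ l = 3 → ∃ o, HasRationalOrder (geodesicTorsion f ν γ) o ∧
      (((l : ℤ) - 3 : ℤ) : WithTop ℤ) ≤ o ∧
      (l < 3 → (o = (((l : ℤ) - 3 : ℤ) : WithTop ℤ) ↔ wc ≠ 0)) ∧
      (l = 3 → (o = (((l : ℤ) - 3 : ℤ) : WithTop ℤ) ↔
        2 * ((l - 1)! : ℝ) * κt + iteratedDeriv (l - 2) (planarCurvature γt) 0 * wc ≠ 0))) ∧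
    (4 ≤ l → ∃ o, HasRationalOrder (geodesicTorsion f ν γ) o ∧ ((0 : ℤ) : WithTop ℤ) ≤ o ∧
      (o = ((0 : ℤ) : WithTop ℤ) ↔ κt ≠ 0)) := by
  obtain ⟨L, a, b₀, b, h⟩ := hΘ.exists_edgeNormalized
  obtain ⟨i1, i2⟩ := h.cuspidal_invariants hξη
  rw [i1] at hκt
  rw [i2] at hwc
  have hbv := h.fderiv_ne_zero hf
  have hwc0 : wc ≠ 0 := by rw [hwc]; positivity
  -- the curve
  set x : ℝ → ℝ := fun t => (γt t).1 with hxdef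
  have hxγ : ∀ᶠ t in 𝓝 0, γt t = (x t, t) := by
    obtain ⟨s, σ, -, hsγ⟩ := hγt
    exact hsγ.mono fun t ht => Prod.ext rfl ht.2
  have hx : SmoothGerm x 0 := by
    obtain ⟨s, σ, hs, hsγ⟩ := hγt
    refine SmoothGerm.congr (f := fun t => (Θ (γ (s t))).1) ?_
      (hsγ.mono fun t ht => by simp only [hxdef, ht.1])
    refine (SmoothGerm.comp ?_ (SmoothGerm.comp ?_ hs.smooth)).fst
    · rw [hs.map_zero, hγ0]; exact h.diffeo.smooth
    · rw [hs.map_zero]; exact hγ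
  obtain ⟨hord1, hord2⟩ := germOrder_eq_natCast_iff.1 hcontact
  obtain ⟨z₀, hz₀, hxz⟩ := hx.exists_eq_pow_mul l hord1
  have hz₀0 : z₀ 0 ≠ 0 := (germOrder_eq_natCast_iff_of_eq hz₀ hxz).1 hcontact
  -- From here `m = l - 2` is the order of `X`, and `z₀(0)` is the leading coefficient of `x`.
  obtain ⟨m, rfl⟩ := Nat.exists_eq_add_of_le hl
  set X : ℝ → ℝ := fun t => t ^ m * z₀ t with hXdef
  have hX : SmoothGerm X 0 := by fun_prop
  have hxX : x =ᶠ[𝓝 0] fun t => t ^ 2 * X t := hxz.mono fun t ht => by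
    rw [ht, hXdef]; ring
  obtain ⟨α₂, β₂, B₁, hα₂, hβ₂, hB₁, eα, eβ, eB, hβ0, hB0⟩ :=
    exists_coefficients_along h.smooth_a h.smooth_b₀ h.smooth_b h.b_zero hx hX hxX
  obtain ⟨σ, U₁, U₂, U₃, hσ, hσ0, hσ', s1, s2, s3, n1, n2, n3, hcurv⟩ :=
    h.exists_curvatures_eq hν hγ hγ0 hγt hx hX hxX hxγ
  have hx0 : x 0 = 0 := by simpa using hxX.eq_of_nhds
  have sX := hX.deriv
  set y : ℝ → ℝ := fun t => 2 * X t + t * deriv X t with hy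
  set α : ℝ → ℝ := fun t => edgeAlpha a (x t, t)
  set β : ℝ → ℝ := fun t => edgeBeta b₀ b (x t, t)
  set B : ℝ → ℝ := fun t => edgeB b (x t, t)
  have sy : SmoothGerm y 0 := by fun_prop
  have sα : SmoothGerm α 0 := h.smooth_a.edgeAlpha.comp_graph hx hx0
  have sβ : SmoothGerm β 0 := (SmoothGerm.edgeBeta h.smooth_b₀ h.smooth_b).comp_graph hx hx0
  have sB : SmoothGerm B 0 := h.smooth_b.edgeB.comp_graph hx hx0
  have sG := SmoothGerm.reducedGeodesic sy sα sβ sB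
  have sN := SmoothGerm.reducedNormal sy sα sβ sB
  have sT := SmoothGerm.reducedTorsion sy sα sβ sB
  have hgeo {k : ℕ} {z : ℝ → ℝ} (hz : SmoothGerm z 0)
      (hk : reducedGeodesic y α β B =ᶠ[𝓝 0] fun t => t ^ k * z t) :=
    exists_hasRationalOrder_of_unit_mul_comp s1 n1 hσ hσ0 hσ' sG hz hk hσ (.const 1)
      (germOrder_eq_one hσ0 hσ') germOrder_one (hcurv.mono fun r hr => hr.1)
  have hnor {k : ℕ} {z : ℝ → ℝ} (hz : SmoothGerm z 0)
      (hk : reducedNormal y α β B =ᶠ[𝓝 0] fun t => t ^ k * z t) :=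
    exists_hasRationalOrder_of_unit_mul_comp s2 n2 hσ hσ0 hσ' sN hz hk (.const 1) hσ
      germOrder_one (germOrder_eq_one hσ0 hσ') (hcurv.mono fun r hr => hr.2.1)
  have htor {k : ℕ} {z : ℝ → ℝ} (hz : SmoothGerm z 0)
      (hk : reducedTorsion y α β B =ᶠ[𝓝 0] fun t => t ^ k * z t) :=
    exists_hasRationalOrder_of_unit_mul_comp s3 n3 hσ hσ0 hσ' sT hz hk (.const 1) hσ
      germOrder_one (germOrder_eq_one hσ0 hσ') (hcurv.mono fun r hr => hr.2.2)
  obtain ⟨G0, N0, T0⟩ := reduced_zero (y := y) hα₂ hβ₂ hB₁ eα eβ eB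
  have hy0 : y 0 = 2 * X 0 := by simp [hy]
  have hy'0 : deriv y 0 = 3 * deriv X 0 := by
    have e := (hX.hasDerivAt.const_mul 2).add ((hasDerivAt_id (0 : ℝ)).mul sX.hasDerivAt)
    refine (HasDerivAt.deriv (f := y) e).trans ?_
    simp
    ring
  -- factorization of `y`
  have hyj {j : ℕ} {Z : ℝ → ℝ} (hZ : SmoothGerm Z 0) (hXZ : X = fun t => t ^ (j + 1) * Z t) :
      SmoothGerm (fun t => ((j : ℝ) + 3) * Z t + t * deriv Z t) 0 ∧
      y =ᶠ[𝓝 0] fun t => t ^ (j + 1) * (((j : ℝ) + 3) * Z t + t * deriv Z t) := by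
    have sZ := hZ.deriv
    refine ⟨by fun_prop, ?_⟩
    filter_upwards [deriv_eventuallyEq_of_eq_pow_mul hZ
      (Eventually.of_forall fun t => congrFun hXZ t)] with t ht
    simp only [hy]
    rw [ht, congrFun hXZ t]
    ring
  refine ⟨?_, ?_, ?_, ?_, ?_, ?_⟩
  · intro h2
    obtain rfl : m = 0 := by omega
    obtain ⟨o, o1, o2, o3⟩ := hgeo (k := 0) sG (by simp)
    refine ⟨o, o1, by simpa using o2, ?_⟩
    rw [show 2 + 0 - 1 = 1 from rfl, iteratedDeriv_one_planarCurvature hxγ hX hxX]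
    rw [G0, hy'0] at o3
    simpa using o3
  · rintro (h3 | h4)
    · obtain rfl : m = 1 := by omega
      obtain ⟨o, o1, o2, o3⟩ := hgeo (k := 0) sG (by simp)
      have hX' : deriv X 0 = z₀ 0 := by
        -- For `l = 3` one has `X = t z₀`, so the numerator at `0` is `-3 z₀(0) ≠ 0`.
        simpa using (deriv_eventuallyEq_of_eq_pow_mul (n := 0) hz₀
          (Eventually.of_forall fun t => congrFun hXdef t)).eq_of_nhds
      rw [G0, hy'0, hX'] at o3
      have := o3.2 (by simpa using hz₀0)
      rw [this] at o1
      exact o1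
    · obtain rfl : m = 2 := by omega
      obtain ⟨sY, eY⟩ := hyj (j := 1) hz₀ hXdef
      obtain ⟨z, hz, hzG, hz0⟩ := reducedGeodesic_eq_mul hα₂ hβ₂ hB₁ sY eα eβ eB eY
      obtain ⟨o, o1, o2, o3⟩ := hgeo hz hzG
      have := o3.2 (by
        rw [hz0]
        have : (1 : ℝ) + 3 ≠ 0 := by norm_num
        simp [hz₀0, this])
      rw [this] at o1
      exact o1
  · intro h5
    obtain ⟨n, rfl⟩ := Nat.exists_eq_add_of_le (show 3 ≤ m by omega)
    have sZ : SmoothGerm (fun t => t ^ n * z₀ t) 0 := by fun_prop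
    -- Here `n = l - 5`, and the cofactor of `t³` in `y` is `5 z₀(0)` at `0` if `n = 0` and vanishes
    -- there otherwise.
    obtain ⟨sY, eY⟩ := hyj (j := 2) sZ (by rw [hXdef]; ext t; ring)
    obtain ⟨z, hz, hzG, hz0⟩ := reducedGeodesic_eq_sq_mul hα₂ hβ₂ hB₁ sY eα eβ eB eY
    obtain ⟨o, o1, o2, o3⟩ := hgeo hz hzG
    have hX0 : X 0 = 0 := by simp [hXdef]
    rw [hX0, zero_mul, zero_add] at hβ0
    refine ⟨o, o1, o2, fun e5 => ?_, fun e5 => ?_⟩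
    · obtain rfl : n = 0 := by omega
      refine o3.trans (not_congr ?_)
      have hx5 : x =ᶠ[𝓝 0] fun t => t ^ 5 * z₀ t := hxz
      rw [show 2 + (3 + 0) - 2 = 3 from rfl, iteratedDeriv_three_planarCurvature hxγ hz₀ hx5, hz0,
        hβ0, hB0, hκt, hwc]
      simp [Nat.factorial]
      -- The coefficient is `-15 z₀(0) - κ_t ω / 4`, and the stated expression `24 κ_t ω + 1440
      -- z₀(0)` is `-96` times it.
      constructor <;> intro e <;> linarith
    · refine o3.trans (not_congr ?_)
      have hn : n ≠ 0 := by omega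
      rw [hz0, hβ0, hB0, hκt, hwc]
      simp [hn, or_comm]
  · obtain ⟨o, o1, o2, o3⟩ := hnor (k := 0) sN (by simp)
    have := o3.2 (by rw [N0, hB0]; positivity)
    rw [this] at o1
    exact o1
  · rintro (h2 | h3)
    · obtain rfl : m = 0 := by omega
      obtain ⟨o, o1, o2, o3⟩ := htor (k := 0) sT (by simp)
      refine ⟨o, o1, o2, fun _ => o3.trans ?_, fun e => absurd e (by norm_num)⟩
      -- The value is `3 X(0) b_v(0)`. It is nonzero, and so is the cuspidal curvature, so both
      -- sides of the equivalence hold.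
      rw [T0, hy0, hB0]
      simp [hXdef, hz₀0, hbv, hwc0]
    · obtain rfl : m = 1 := by omega
      obtain ⟨sY, eY⟩ := hyj (j := 0) hz₀ hXdef
      obtain ⟨z, hz, hzT, hz0⟩ := reducedTorsion_eq_mul hα₂ hβ₂ hB₁ sY eα eβ eB eY
      obtain ⟨o, o1, o2, o3⟩ := htor hz hzT
      refine ⟨o, o1, o2, fun e => absurd e (by norm_num), fun _ => o3.trans (not_congr ?_)⟩
      have hX0 : X 0 = 0 := by simp [hXdef]
      have hX' : deriv X 0 = z₀ 0 := by
        simpa using (deriv_eventuallyEq_of_eq_pow_mul (n := 0) hz₀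
          (Eventually.of_forall fun t => congrFun hXdef t)).eq_of_nhds
      rw [show 2 + 1 - 2 = 1 from rfl, iteratedDeriv_one_planarCurvature hxγ hX hxX, hX', hz0, hβ0,
        hB0, hX0, hκt, hwc]
      simp
      -- The coefficient is `3 z₀(0) ω / 2 - κ_t`, and the stated expression `4 κ_t - 6 z₀(0) ω` is
      -- `-4` times it.
      constructor <;> intro e <;> linarith
  · intro h4
    obtain ⟨n, rfl⟩ := Nat.exists_eq_add_of_le (show 2 ≤ m by omega)
    have sZ : SmoothGerm (fun t => t ^ (n + 1) * z₀ t) 0 := by fun_prop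
    -- Only one factor `t` is extracted from `y`; its cofactor still vanishes at `0`, so `-2 β₂(0) =
    -- -κ_t` is all that remains.
    obtain ⟨sY, eY⟩ := hyj (j := 0) sZ (by rw [hXdef]; ext t; ring)
    obtain ⟨z, hz, hzT, hz0⟩ := reducedTorsion_eq_mul hα₂ hβ₂ hB₁ sY eα eβ eB eY
    obtain ⟨o, o1, o2, o3⟩ := htor hz hzT
    refine ⟨o, o1, o2, o3.trans (not_congr ?_)⟩
    have hX0 : X 0 = 0 := by simp [hXdef]
    rw [hz0, hβ0, hX0, hκt]
    simp
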